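/- Circuit model. Let $\mathcal N$ be a single-qubit channel with normal form parameters $\mathbf t,\mathbf D\in\mathbb R^3$, i.e. $\mathcal N(\cdot)=U\mathcal N'(V^\dagger(\cdot)V)U^\dagger$ with $U,V$ unitary, $\mathcal N'(I)=I+\sum_Q t_QQ$ and $\mathcal N'(Q)=D_QQ$ for $Q\in\{X,Y,Z\}$, and put $c=\frac13(\|\mathbf t\|_2^2+\|\mathbf D\|_2^2)$. A random circuit ansatz of depth $L\ge1$ on $n$ qubits is $$\Phi=(\mathcal V_L\circ\mathcal N^{\otimes n}\circ\mathcal U_L)\circ\cdots\circ(\mathcal V_1\circ\mathcal N^{\otimes n}\circ\mathcal U_1).$$ Each $\mathcal U_\ell$ is a product of two-qubit gates on arbitrary pairs of qubits (arbitrary architecture), of two kinds: random gates, each distributed according to a unitary 2-design on two qubits, and parametrized gates $\exp(-i\theta_\mu H_\mu)$ with $H_\mu$ Hermitian and a real parameter $\theta_\mu$ of their own; in each layer each qubit is acted on by at least one random gate. $\mathcal V_L$, and each $\mathcal V_\ell$ with $\ell<L$ that is present, is a layer of single-qubit random gates on all qubits, each distributed according to a single-qubit 2-design. A $\mathcal V_\ell$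 with $\ell<L$ may be absent (the identity), provided that on each qubit the first gate of $\mathcal U_{\ell+1}$ is a random one. (So if all $\mathcal V_\ell$ are present, parametrized gates may stand anywhere, in particular at the start of a layer.) All random gates are independent. Proposition (Improved upper bound on the partial derivative for unital noise). Let $C(\theta)=\mathrm{Tr}(P\,\Phi(\rho_0))$, where $P\in\{I,X,Y,Z\}^{\otimes n}$ has weight $|P|$ (number of letters different from $I$), $\rho_0$ is an arbitrary $n$-qubit state, and $\Phi$ is a circuit as above of depth $L\ge 1$. Assume that $\mathcal N$ is unital, $\mathcal N(I)=I$. Then, with variances over the random gates and for every value of the parameters, $$\mathrm{Var}[C]\le 4c^{|P|+L-1},$$ and, for every parameter $\mu$ of a two-qubit gate $\exp(-i\theta_\mu H_\mu)$ in the circuit with $\|H_\mu\|_\infty\le1$, $$\mathrm{Var}[\partial_\mu C]\le 4c^{|P|+L-1}.$$ If moreover $\mathcal N$ is not a unitary channel, then $c<1$, and therefore $\mathrm{Var}[\partial_\mu C]\le\exp(-\Omega(|P|+L))$: there are $\alpha>0$ and $m_0$, depending only on $\mathcal N$, such that $\mathrm{Var}[\partial_\mu C]\le e^{-\alpha(|P|+L)}$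 whenever $|P|+L\ge m_0$. -/

import Mathlib

open MeasureTheory ProbabilityTheory
open scoped Kronecker ComplexOrder

noncomputable section

/-! ### Unitary groups, Haar probability measure, unitary 2-designs -/

/-- The group `U(ι)` of unitary matrices with rows and columns indexed by `ι`. -/
abbrev UGroup (ι : Type) [Fintype ι] [DecidableEq ι] : Type := Matrix.unitaryGroup ι ℂ

instance instMeasurableSpaceUGroup (ι : Type) [Fintype ι] [DecidableEq ι] :
    MeasurableSpace (UGroup ι) := borel _

instance instBorelSpaceUGroup (ι : Type) [Fintype ι] [DecidableEq ι] :
    BorelSpace (UGroup ι) := ⟨rfl⟩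

instance instCompactSpaceUGroup (ι : Type) [Fintype ι] [DecidableEq ι] :
    CompactSpace (UGroup ι) := by
  refine isCompact_iff_compactSpace.mp ?_
  have hK : IsCompact (Set.pi Set.univ fun _ : ι => Set.pi Set.univ fun _ : ι =>
      Metric.closedBall (0 : ℂ) 1) :=
    isCompact_univ_pi fun _ => isCompact_univ_pi fun _ => isCompact_closedBall _ _
  refine IsCompact.of_isClosed_subset hK ?_ ?_
  · have h : (Matrix.unitaryGroup ι ℂ : Set (Matrix ι ι ℂ)) =
        {A | star A * A = 1} ∩ {A | A * star A = 1} := by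
      ext A
      exact Unitary.mem_iff
    rw [h]
    exact (isClosed_eq (by fun_prop) continuous_const).inter
      (isClosed_eq (by fun_prop) continuous_const)
  · intro A hA i _ j _
    simpa using entry_norm_bound_of_unitary hA i j

/-- The Haar probability measure on `U(ι)`. -/
def haarProb (ι : Type) [Fintype ι] [DecidableEq ι] : Measure (UGroup ι) :=
  Measure.haarMeasure ⊤

/-- `ν` is a unitary 2-design:
`𝔼_{U ∼ ν} [U^{⊗2} O U^{†⊗2}] = 𝔼_{U ∼ Haar} [U^{⊗2} O U^{†⊗2}]` for every operator `O`
(the matrix identity is written entrywise). -/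
def IsTwoDesign {ι : Type} [Fintype ι] [DecidableEq ι] (ν : Measure (UGroup ι)) : Prop :=
  ∀ (O : Matrix (ι × ι) (ι × ι) ℂ) (a b : ι × ι),
    ∫ U : UGroup ι, (((U : Matrix ι ι ℂ) ⊗ₖ (U : Matrix ι ι ℂ)) * O *
        ((U : Matrix ι ι ℂ) ⊗ₖ (U : Matrix ι ι ℂ)).conjTranspose) a b ∂ν =
    ∫ U : UGroup ι, (((U : Matrix ι ι ℂ) ⊗ₖ (U : Matrix ι ι ℂ)) * O *
        ((U : Matrix ι ι ℂ) ⊗ₖ (U : Matrix ι ι ℂ)).conjTranspose) a b ∂(haarProb ι)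

/-! ### Qubits, Pauli operators, states -/

/-- Operators on one qubit. -/
abbrev Op1 : Type := Matrix (Fin 2) (Fin 2) ℂ

/-- Operators on two qubits. -/
abbrev Op2 : Type := Matrix (Fin 2 × Fin 2) (Fin 2 × Fin 2) ℂ

/-- Operators on `n` qubits; the computational basis is indexed by bit strings. -/
abbrev QOp (n : ℕ) : Type := Matrix (Fin n → Fin 2) (Fin n → Fin 2) ℂ

/-- The Pauli matrices `I, X, Y, Z`, in this order. -/
def pauli : Fin 4 → Op1 :=
  ![1, !![0, 1; 1, 0], !![0, -Complex.I; Complex.I, 0], !![1, 0; 0, -1]]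

/-- The tensor product `A₁ ⊗ ⋯ ⊗ Aₙ` of single-qubit operators. -/
def tensorOp {n : ℕ} (A : Fin n → Op1) : QOp n :=
  fun x y => ∏ k, A k (x k) (y k)

/-- The element of the Pauli basis `{I, X, Y, Z}^{⊗n}` with letters `p`. -/
def pauliString {n : ℕ} (p : Fin n → Fin 4) : QOp n :=
  tensorOp fun k => pauli (p k)

/-- The Pauli weight: the number of letters different from `I`. -/
def pauliWeight {n : ℕ} (p : Fin n → Fin 4) : ℕ :=
  (Finset.univ.filter fun k => p k ≠ 0).card

/-- Density matrices on `n` qubits. -/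
def IsState {n : ℕ} (ρ : QOp n) : Prop := ρ.PosSemidef ∧ ρ.trace = 1

/-- A two-qubit operator `G` acting on the (distinct) qubits `i`, `j` and as the identity on
all the others. -/
def onQubits {n : ℕ} (i j : Fin n) (G : Op2) : QOp n :=
  fun x y => if ∀ k, k ≠ i → k ≠ j → x k = y k then G (x i, x j) (y i, y j) else 0

/-! ### Single-qubit noise channels -/

/-- The ampliation `N ⊗ id` on `ℂ² ⊗ ℂ^d`. -/
def ampliation (N : Op1 →ₗ[ℂ] Op1) (d : ℕ) (S : Matrix (Fin 2 × Fin d) (Fin 2 × Fin d) ℂ) :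
    Matrix (Fin 2 × Fin d) (Fin 2 × Fin d) ℂ :=
  fun a b => N (fun i j => S (i, a.2) (j, b.2)) a.1 b.1

/-- Single-qubit quantum channels: completely positive and trace-preserving linear maps. -/
def IsChannel (N : Op1 →ₗ[ℂ] Op1) : Prop :=
  (∀ (d : ℕ) (S : Matrix (Fin 2 × Fin d) (Fin 2 × Fin d) ℂ),
    S.PosSemidef → (ampliation N d S).PosSemidef) ∧
  ∀ A, (N A).trace = A.trace

/-- Unital maps. -/
def IsUnital (N : Op1 →ₗ[ℂ] Op1) : Prop := N 1 = 1

/-- Unitary channels. -/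
def IsUnitaryChannel (N : Op1 →ₗ[ℂ] Op1) : Prop :=
  ∃ U : UGroup (Fin 2), ∀ A, N A = (U : Op1) * A * (U : Op1).conjTranspose

/-- `t, D ∈ ℝ³` are normal form parameters of `N`: `N = U N'(V† (·) V) U†` with unitaries `U`,
`V`, where `N'(I) = I + t · σ` and `N'(Q) = D_Q Q` for `Q = X, Y, Z`. -/
def IsNormalForm (N : Op1 →ₗ[ℂ] Op1) (t D : EuclideanSpace ℝ (Fin 3)) : Prop :=
  ∃ (U V : UGroup (Fin 2)) (N' : Op1 →ₗ[ℂ] Op1),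
    N' 1 = 1 + ∑ q : Fin 3, (t q : ℂ) • pauli q.succ ∧
    (∀ q : Fin 3, N' (pauli q.succ) = (D q : ℂ) • pauli q.succ) ∧
    ∀ A, N A = (U : Op1) * N' ((V : Op1).conjTranspose * A * (V : Op1)) *
      (U : Op1).conjTranspose

/-- The noise constant `c = (‖t‖₂² + ‖D‖₂²) / 3`. -/
def noiseConst (t D : EuclideanSpace ℝ (Fin 3)) : ℝ := (‖t‖ ^ 2 + ‖D‖ ^ 2) / 3

/-- The `n`-fold tensor power `N^{⊗n}`, through its values on matrix units:
`N^{⊗n}(|x'⟩⟨y'|) = ⨂ₖ N(|x'ₖ⟩⟨y'ₖ|)`. -/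
def tensorPower (N : Op1 →ₗ[ℂ] Op1) (n : ℕ) (ρ : QOp n) : QOp n :=
  ∑ x', ∑ y', ρ x' y' • tensorOp fun k => N (Matrix.single (x' k) (y' k) 1)

/-! ### Random parametrized circuits -/

/-- A random parametrized circuit ansatz on `n` qubits with `L` layers of two-qubit gates, of
arbitrary architecture. The gates of layer `ℓ` occupy the positions `(ℓ, 0), (ℓ, 1), …`, in the
order in which they are applied. A position carries either a parametrized gate
`exp(-i θ H)` (`generator = some H`) or a random gate (`generator = none`). -/
structure RandomCircuit (n L : ℕ) where
  /-- the number of two-qubit gates in each layer -/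
  len : Fin L → ℕ
  /-- first qubit on which the gate acts -/
  fst : (Σ ℓ, Fin (len ℓ)) → Fin n
  /-- second qubit on which the gate acts -/
  snd : (Σ ℓ, Fin (len ℓ)) → Fin n
  fst_ne_snd : ∀ g, fst g ≠ snd g
  /-- `some H` for a parametrized gate with generator `H`, `none` for a random gate -/
  generator : (Σ ℓ, Fin (len ℓ)) → Option Op2
  isHermitian : ∀ g H, generator g = some H → H.IsHermitian
  /-- in each layer, each qubit is acted on by at least one random gate -/
  covers : ∀ (ℓ : Fin L) (q : Fin n), ∃ s : Fin (len ℓ),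
    generator ⟨ℓ, s⟩ = none ∧ (fst ⟨ℓ, s⟩ = q ∨ snd ⟨ℓ, s⟩ = q)
  /-- the laws of the random two-qubit gates (at a position that carries a parametrized gate,
  the value is never used) -/
  gateLaw : (Σ ℓ, Fin (len ℓ)) → Measure (UGroup (Fin 2 × Fin 2))
  gateLaw_prob : ∀ g, IsProbabilityMeasure (gateLaw g)
  gateLaw_design : ∀ g, generator g = none → IsTwoDesign (gateLaw g)
  /-- whether layer `ℓ` ends, after the noise, with single-qubit random gates on all qubits -/
  hasSingle : Fin L → Bool
  /-- the circuit ends with single-qubit random gates -/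
  hasSingle_last : ∀ ℓ : Fin L, (ℓ : ℕ) + 1 = L → hasSingle ℓ = true
  /-- if layer `ℓ` does not end with single-qubit random gates, then on each qubit the first gate
  of layer `ℓ + 1` is a random one -/
  random_first : ∀ ℓ ℓ' : Fin L, (ℓ' : ℕ) = ℓ + 1 → hasSingle ℓ = false →
    ∀ (q : Fin n) (s : Fin (len ℓ')), (fst ⟨ℓ', s⟩ = q ∨ snd ⟨ℓ', s⟩ = q) →
      (∀ s' : Fin (len ℓ'), s' < s → fst ⟨ℓ', s'⟩ ≠ q ∧ snd ⟨ℓ', s'⟩ ≠ q) →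
      generator ⟨ℓ', s⟩ = none
  /-- the laws of the single-qubit gates (never used for a layer without them) -/
  singleLaw : Fin L × Fin n → Measure (UGroup (Fin 2))
  singleLaw_prob : ∀ k, IsProbabilityMeasure (singleLaw k)
  singleLaw_design : ∀ k, hasSingle k.1 = true → IsTwoDesign (singleLaw k)

namespace RandomCircuit

variable {n L : ℕ}

/-- The positions of the two-qubit gates. -/
abbrev Pos (C : RandomCircuit n L) : Type := Σ ℓ, Fin (C.len ℓ)

/-- The sampled gates: the two-qubit ones and the single-qubit ones. -/
abbrev Sample (C : RandomCircuit n L) : Type :=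
  (C.Pos → UGroup (Fin 2 × Fin 2)) × (Fin L × Fin n → UGroup (Fin 2))

/-- The law of the circuit: all gates are drawn independently. -/
def law (C : RandomCircuit n L) : Measure C.Sample :=
  (Measure.pi C.gateLaw).prod (Measure.pi C.singleLaw)

/-- The two-qubit gate at position `g`. -/
def gate (C : RandomCircuit n L) (θ : C.Pos → ℝ) (ω : C.Sample) (g : C.Pos) : Op2 :=
  match C.generator g with
  | none => (ω.1 g : Op2)
  | some H => NormedSpace.exp ((-(Complex.I * (θ g : ℂ))) • H)

/-- The unitary channel `𝒰_ℓ` of the two-qubit gates of layer `ℓ`. -/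
def gateLayer (C : RandomCircuit n L) (θ : C.Pos → ℝ) (ω : C.Sample) (ℓ : Fin L)
    (ρ : QOp n) : QOp n :=
  (List.finRange (C.len ℓ)).foldl (fun σ s =>
    onQubits (C.fst ⟨ℓ, s⟩) (C.snd ⟨ℓ, s⟩) (C.gate θ ω ⟨ℓ, s⟩) * σ *
      (onQubits (C.fst ⟨ℓ, s⟩) (C.snd ⟨ℓ, s⟩) (C.gate θ ω ⟨ℓ, s⟩)).conjTranspose) ρ

/-- The unitary channel `𝒱_ℓ` of the single-qubit gates that end layer `ℓ` (the identity if
there are none). -/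
def singleLayer (C : RandomCircuit n L) (ω : C.Sample) (ℓ : Fin L) (ρ : QOp n) : QOp n :=
  if C.hasSingle ℓ = true then
    tensorOp (fun q => (ω.2 (ℓ, q) : Op1)) * ρ *
      (tensorOp (fun q => (ω.2 (ℓ, q) : Op1))).conjTranspose
  else ρ

/-- The noisy circuit
`Φ = (𝒱_L ∘ N^{⊗n} ∘ 𝒰_L) ∘ ⋯ ∘ (𝒱_1 ∘ N^{⊗n} ∘ 𝒰_1)`. -/
def channel (C : RandomCircuit n L) (N : Op1 →ₗ[ℂ] Op1) (θ : C.Pos → ℝ) (ω : C.Sample)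
    (ρ : QOp n) : QOp n :=
  (List.finRange L).foldl (fun σ ℓ =>
    C.singleLayer ω ℓ (tensorPower N n (C.gateLayer θ ω ℓ σ))) ρ

/-- The cost function `C(θ) = Tr(P Φ(ρ₀))` (a real number). -/
def cost (C : RandomCircuit n L) (N : Op1 →ₗ[ℂ] Op1) (ρ₀ : QOp n) (p : Fin n → Fin 4)
    (θ : C.Pos → ℝ) (ω : C.Sample) : ℝ :=
  (pauliString p * C.channel N θ ω ρ₀).trace.re

/-- The cost function with all parameters but the one at position `μ` kept at `θ`. -/
def costAlong (C : RandomCircuit n L) (N : Op1 →ₗ[ℂ] Op1) (ρ₀ : QOp n) (p : Fin n → Fin 4)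
    (θ : C.Pos → ℝ) (μ : C.Pos) (ω : C.Sample) (s : ℝ) : ℝ :=
  C.cost N ρ₀ p (Function.update θ μ s) ω

/-- The partial derivative `∂_μ C` at `θ`. -/
def costDeriv (C : RandomCircuit n L) (N : Op1 →ₗ[ℂ] Op1) (ρ₀ : QOp n) (p : Fin n → Fin 4)
    (θ : C.Pos → ℝ) (μ : C.Pos) (ω : C.Sample) : ℝ :=
  deriv (C.costAlong N ρ₀ p θ μ ω) (θ μ)

end RandomCircuit

end

namespace NoisyCircuit

noncomputable section

open Matrix
open scoped Matrix.Norms.L2Operator ENNReal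

/-! ### Conjugation maps, tensor products, operators on two qubits -/

/-! The proof bounds the second moment of `Tr(P Φ(ρ₀))`, which dominates the variance, by moving
random single-qubit unitaries next to the noise and reading the circuit backwards.

A 2-design has the second moments of Haar measure, so multiplying a random gate on the right by a
fixed unitary does not change them (`integral_norm_sq_shiftSample`). Hence any product of
single-qubit unitaries can be inserted after each noise layer: it is absorbed by the single-qubit
layer if there is one, and otherwise each factor slides forward to the first gate on its qubit,
which is random (`probeMap_shiftSample`). Averaging over finitely many insertions with the sample
held fixed leaves a deterministic estimate for each sample. Parametrized gates enter it only through
their unitarity.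

The insertions are Pauli matrices times rotations permuting `X, Y, Z` cyclically. The Pauli part
removes cross terms between different strings, and the rotations average the three contraction
factors of the noise (`sum_norm_sq_twirl`, `sum_prod_axisPerm`). By unitality the dual of the noise
sends a traceless Pauli matrix to a traceless Hermitian matrix, which is a multiple of a unitary.
Its operator norm is therefore its normalized Frobenius norm (`heisenberg_mul_conjTranspose`), and a
string of weight `k` costs `c ^ k` after averaging (`sum_norm_sq_twirled_noise_le`). The last layer
meets only strings of weight `|P|`, because local unitaries preserve weight, and contributes `c ^
|P|` (`sum_twirledCircuit_pauliString_le`). Each of the other `L - 1` layers meets a traceless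
observable, whose strings have weight at least one, and contributes a factor `c`
(`sum_twirledCircuit_le`).

Differentiation inserts `σ ↦ -i[H, σ]` after one gate (`hasDerivAt_costAlong`). Its dual at most
doubles the operator norm, which gives the constant `4`. Finally `1 + 3c` is the squared Frobenius
norm of the Choi matrix, a positive matrix of trace `2`. So `c ≤ 1`, with equality only in rank one,
that is for unitary channels (`contraction_lt_one`). For `P = I` the cost is constant and is treated
separately. -/

/-- The linear map `σ ↦ A σ A†`. -/
def conjMap {ι : Type} [Fintype ι] (A : Matrix ι ι ℂ) : Matrix ι ι ℂ →ₗ[ℂ] Matrix ι ι ℂ where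
  toFun σ := A * σ * Aᴴ
  map_add' := by intros; simp [mul_add, add_mul]
  map_smul' := by intros; simp

section conj
variable {ι : Type} [Fintype ι]

@[simp] lemma conjMap_apply (A σ : Matrix ι ι ℂ) : conjMap A σ = A * σ * Aᴴ := rfl

lemma conjMap_one [DecidableEq ι] : conjMap (1 : Matrix ι ι ℂ) = LinearMap.id := by
  ext1; simp

lemma conjMap_mul (A B : Matrix ι ι ℂ) : conjMap (A * B) = conjMap A ∘ₗ conjMap B := by
  ext1 σ; simp [Matrix.mul_assoc]

lemma norm_entry_le [DecidableEq ι] (A : Matrix ι ι ℂ) (i j : ι) : ‖A i j‖ ≤ ‖A‖ := by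
  have h := l2_opNorm_mulVec A (EuclideanSpace.single j (1 : ℂ))
  simp only [PiLp.norm_single, norm_one, mul_one] at h
  refine le_trans ?_ h
  have h2 := PiLp.norm_apply_le (WithLp.toLp 2 (A *ᵥ (EuclideanSpace.single j (1 : ℂ)).ofLp)
    : EuclideanSpace ℂ ι) i
  simpa using h2

lemma norm_of_unitary [DecidableEq ι] [Nonempty ι] {U : Matrix ι ι ℂ}
    (hU : U ∈ unitaryGroup ι ℂ) : ‖U‖ = 1 :=
  CStarRing.norm_of_mem_unitary hU

lemma norm_conjMap_unitary_le [DecidableEq ι] {U : Matrix ι ι ℂ}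
    (hU : U ∈ unitaryGroup ι ℂ) (X : Matrix ι ι ℂ) : ‖Uᴴ * X * U‖ ≤ ‖X‖ := by
  rcases isEmpty_or_nonempty ι with h | h
  · have : Uᴴ * X * U = X := Subsingleton.elim _ _
    rw [this]
  · calc ‖Uᴴ * X * U‖ ≤ ‖Uᴴ * X‖ * ‖U‖ := norm_mul_le _ _
      _ ≤ ‖Uᴴ‖ * ‖X‖ * ‖U‖ := by gcongr; exact norm_mul_le _ _
      _ = ‖X‖ := by rw [l2_opNorm_conjTranspose, norm_of_unitary hU]; simp

/-- The squared norm of a column is a diagonal entry of `Xᴴ * X`, whose operator norm is `‖X‖ ^ 2`.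
-/
lemma sum_norm_sq_entry_le [DecidableEq ι] (X : Matrix ι ι ℂ) :
    ∑ a, ∑ b, ‖X a b‖ ^ 2 ≤ Fintype.card ι * ‖X‖ ^ 2 := by
  rw [Finset.sum_comm]
  have key : ∀ b, ∑ a, ‖X a b‖ ^ 2 ≤ ‖X‖ ^ 2 := by
    intro b
    have h1 := norm_entry_le (Xᴴ * X) b b
    rw [l2_opNorm_conjTranspose_mul_self, mul_apply] at h1
    have h2 : ∑ a, Xᴴ b a * X a b = ((∑ a, ‖X a b‖ ^ 2 : ℝ) : ℂ) := by
      push_cast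
      refine Finset.sum_congr rfl fun a _ => ?_
      rw [conjTranspose_apply, ← Complex.conj_mul']; rfl
    rw [h2, Complex.norm_real, Real.norm_of_nonneg (by positivity)] at h1
    linarith [h1, sq (‖X‖)]
  calc _ ≤ ∑ _b : ι, ‖X‖ ^ 2 := Finset.sum_le_sum fun b _ => key b
    _ = _ := by simp

end conj

section tensor
variable {n : ℕ}

lemma tensorOp_mul (A B : Fin n → Op1) : tensorOp A * tensorOp B = tensorOp (fun k => A k * B k) := by
  ext x y
  simp only [tensorOp, mul_apply, ← Finset.prod_mul_distrib]
  rw [Finset.prod_univ_sum]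
  simp

lemma tensorOp_one : tensorOp (fun _ => 1 : Fin n → Op1) = 1 := by
  ext x y
  simp only [tensorOp, one_apply]
  rw [Finset.prod_ite_zero]
  simp [funext_iff]

lemma tensorOp_conjTranspose (A : Fin n → Op1) : (tensorOp A)ᴴ = tensorOp (fun k => (A k)ᴴ) := by
  ext x y
  simp [tensorOp, conjTranspose_apply]

lemma trace_tensorOp (A : Fin n → Op1) : (tensorOp A).trace = ∏ k, (A k).trace := by
  simp only [trace, tensorOp, diag_apply]
  rw [Finset.prod_univ_sum]
  simp

lemma tensorOp_smul (c : Fin n → ℂ) (A : Fin n → Op1) :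
    tensorOp (fun k => c k • A k) = (∏ k, c k) • tensorOp A := by
  ext x y
  simp [tensorOp, Finset.prod_mul_distrib]

lemma tensorOp_mem_unitary {A : Fin n → Op1} (h : ∀ k, A k ∈ unitaryGroup (Fin 2) ℂ) :
    tensorOp A ∈ unitaryGroup (Fin n → Fin 2) ℂ := by
  rw [mem_unitaryGroup_iff, star_eq_conjTranspose, tensorOp_conjTranspose, tensorOp_mul]
  rw [← tensorOp_one]
  congr 1
  funext k
  exact mem_unitaryGroup_iff.mp (h k)

end tensor

section two
variable {n : ℕ}

lemma onQubits_mul {i j : Fin n} (hij : i ≠ j) (A B : Op2) :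
    onQubits i j (A * B) = onQubits i j A * onQubits i j B := by
  ext x y
  rw [mul_apply]
  -- Only the four bit strings that agree with `x` off `i` and `j` contribute to the sum in the
  -- matrix product; `e` enumerates them.
  let e : Fin 2 × Fin 2 → (Fin n → Fin 2) := fun a => Function.update (Function.update x i a.1) j a.2
  have ei : ∀ a, e a i = a.1 := fun a => by simp [e, hij]
  have ej : ∀ a, e a j = a.2 := fun a => by simp [e]
  have ek : ∀ a k, k ≠ i → k ≠ j → e a k = x k := fun a k h1 h2 => by simp [e, h1, h2]
  have hinj : Function.Injective e := fun a b h => by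
    ext
    · rw [← ei a, ← ei b, h]
    · rw [← ej a, ← ej b, h]
  rw [← Fintype.sum_of_injective e hinj
    (fun a => if ∀ k, k ≠ i → k ≠ j → x k = y k then A (x i, x j) a * B a (y i, y j) else 0)]
  · simp only [onQubits, mul_apply]
    split_ifs <;> simp
  · intro z hz
    have : ¬ ∀ k, k ≠ i → k ≠ j → x k = z k := by
      intro h
      refine hz ⟨(z i, z j), ?_⟩
      funext k
      by_cases h1 : k = i
      · subst h1; rw [ei]
      by_cases h2 : k = j
      · subst h2; rw [ej]
      rw [ek _ _ h1 h2, h k h1 h2]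
    simp [onQubits, this]
  · intro a
    have h1 : ∀ k, k ≠ i → k ≠ j → x k = e a k := fun k h1 h2 => (ek a k h1 h2).symm
    have h2 : (∀ k, k ≠ i → k ≠ j → e a k = y k) ↔ ∀ k, k ≠ i → k ≠ j → x k = y k :=
      forall_congr' fun k => forall_congr' fun h1 => forall_congr' fun h2 => by rw [ek a k h1 h2]
    simp only [onQubits, if_pos h1, h2, ei, ej]
    split_ifs <;> simp

lemma onQubits_one (i j : Fin n) : onQubits i j (1 : Op2) = 1 := by
  ext x y
  simp only [onQubits, one_apply, Prod.mk.injEq]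
  by_cases h : x = y
  · simp [h]
  · rw [if_neg h]
    split_ifs with h1 h2
    · exfalso
      apply h
      funext k
      by_cases h3 : k = i
      · rw [h3, h2.1]
      by_cases h4 : k = j
      · rw [h4, h2.2]
      exact h1 k h3 h4
    · rfl
    · rfl

lemma onQubits_conjTranspose (i j : Fin n) (A : Op2) :
    onQubits i j Aᴴ = (onQubits i j A)ᴴ := by
  ext x y
  simp only [onQubits, conjTranspose_apply]
  simp only [eq_comm (a := y _)]
  split_ifs <;> simp

/-- The action on two qubits as a homomorphism of `⋆`-algebras. -/
def onQubitsHom {i j : Fin n} (hij : i ≠ j) : Op2 →⋆ₐ[ℂ] QOp n where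
  toFun := onQubits i j
  map_one' := onQubits_one i j
  map_mul' := onQubits_mul hij
  map_zero' := by ext x y; simp [onQubits]
  map_add' A B := by ext x y; simp only [onQubits, Matrix.add_apply]; split_ifs <;> simp
  commutes' c := by
    rw [Algebra.algebraMap_eq_smul_one, Algebra.algebraMap_eq_smul_one]
    conv_rhs => rw [← onQubits_one i j]
    ext x y
    simp only [onQubits, Matrix.smul_apply]; split_ifs <;> simp
  map_star' A := onQubits_conjTranspose i j A

@[simp] lemma onQubitsHom_apply {i j : Fin n} (hij : i ≠ j) (A : Op2) :
    onQubitsHom hij A = onQubits i j A := rfl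

lemma norm_onQubits_le {i j : Fin n} (hij : i ≠ j) (A : Op2) : ‖onQubits i j A‖ ≤ ‖A‖ :=
  NonUnitalStarAlgHom.norm_apply_le (onQubitsHom hij) A

lemma onQubits_mem_unitary {i j : Fin n} (hij : i ≠ j) {U : Op2}
    (hU : U ∈ unitaryGroup (Fin 2 × Fin 2) ℂ) :
    onQubits i j U ∈ unitaryGroup (Fin n → Fin 2) ℂ := by
  rw [mem_unitaryGroup_iff, star_eq_conjTranspose, ← onQubits_conjTranspose, ← onQubits_mul hij,
    ← star_eq_conjTranspose, mem_unitaryGroup_iff.mp hU, onQubits_one]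

lemma onQubits_kronecker {i j : Fin n} (hij : i ≠ j) (a b : Op1) :
    onQubits i j (a ⊗ₖ b) = tensorOp (Function.update (Function.update (fun _ => 1) i a) j b) := by
  ext x y
  have h : ∀ k, (Function.update (Function.update (fun _ => (1 : Op1)) i a) j b) k =
      if k = i then a else if k = j then b else 1 := by
    intro k
    by_cases h1 : k = i
    · subst h1; simp [hij]
    by_cases h2 : k = j
    · subst h2; simp [h1]
    simp [h1, h2]
  simp only [tensorOp, h]
  rw [← Finset.mul_prod_erase _ _ (Finset.mem_univ i),
    ← Finset.mul_prod_erase _ _ (Finset.mem_erase.mpr ⟨hij.symm, Finset.mem_univ j⟩)]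
  have h3 : ∏ k ∈ (Finset.univ.erase i).erase j,
      (if k = i then a else if k = j then b else 1) (x k) (y k) =
      if ∀ k, k ≠ i → k ≠ j → x k = y k then 1 else 0 := by
    rw [Finset.prod_congr rfl (g := fun k => if x k = y k then (1 : ℂ) else 0)]
    · rw [Finset.prod_ite_zero]
      simp only [Finset.mem_erase, Finset.mem_univ, and_true, Finset.prod_const_one]
      congr 1
      exact propext ⟨fun h k h1 h2 => h k ⟨h2, h1⟩, fun h k h1 => h k h1.2 h1.1⟩
    · intro k hk
      simp only [Finset.mem_erase, Finset.mem_univ, and_true] at hk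
      simp [hk.1, hk.2, one_apply]
  rw [h3]
  simp only [onQubits, kroneckerMap_apply, if_true, if_neg hij.symm]
  split_ifs <;> simp

/-- An operator on the qubits `i`, `j` commutes with tensor products that are trivial there. -/
lemma onQubits_tensorOp_commute {i j : Fin n} (hij : i ≠ j) (A : Op2) (v : Fin n → Op1)
    (hi : v i = 1) (hj : v j = 1) : Commute (onQubits i j A) (tensorOp v) := by
  induction A using Matrix.induction_on with
  | h_add p q hp hq =>
    have h := map_add (onQubitsHom hij) p q
    simp only [onQubitsHom_apply] at h
    rw [h]
    exact hp.add_left hq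
  | h_std_basis p q x =>
    -- Matrix units are Kronecker products, so by linearity the claim reduces to two tensor products
    -- that are never both nontrivial on a qubit.
    have h1 : single p q x = x • (single p.1 q.1 (1 : ℂ) ⊗ₖ single p.2 q.2 (1 : ℂ)) := by
      rw [single_kronecker_single, smul_single]; simp
    have h := map_smul (onQubitsHom hij) x (single p.1 q.1 (1 : ℂ) ⊗ₖ single p.2 q.2 (1 : ℂ))
    simp only [onQubitsHom_apply] at h
    rw [h1, h, onQubits_kronecker hij]
    refine Commute.smul_left ?_ x
    rw [Commute, SemiconjBy, tensorOp_mul, tensorOp_mul]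
    congr 1
    funext k
    by_cases h1 : k = j
    · subst h1; simp [hj]
    by_cases h2 : k = i
    · subst h2; simp [hi]
    simp [h1, h2]

end two

/-! ### Pauli strings -/

section pauli
variable {n : ℕ}

/-- Completeness of the Pauli basis: the sum of `P ⊗ P` over the four letters is twice the swap. -/
lemma sum_pauli_entries (a b c d : Fin 2) :
    ∑ p, pauli p a b * pauli p c d = if a = d ∧ b = c then 2 else 0 := by
  fin_cases a <;> fin_cases b <;> fin_cases c <;> fin_cases d <;>
    simp [Fin.sum_univ_four, pauli] <;> norm_num

lemma pauli_conjTranspose (p : Fin 4) : (pauli p)ᴴ = pauli p := by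
  ext a b
  fin_cases p <;> fin_cases a <;> fin_cases b <;> simp [pauli]

lemma pauli_zero : pauli 0 = 1 := rfl

lemma trace_pauli (p : Fin 4) : (pauli p).trace = if p = 0 then 2 else 0 := by
  fin_cases p <;> simp [pauli, trace_fin_two]

lemma pauli_mul_self (p : Fin 4) : pauli p * pauli p = 1 := by
  ext a b
  fin_cases p <;> fin_cases a <;> fin_cases b <;> simp [pauli, mul_apply, Fin.sum_univ_two]

lemma pauli_mem_unitary (p : Fin 4) : pauli p ∈ unitaryGroup (Fin 2) ℂ := by
  rw [mem_unitaryGroup_iff, star_eq_conjTranspose, pauli_conjTranspose, pauli_mul_self]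

lemma pauliString_mem_unitary (p : Fin n → Fin 4) :
    pauliString p ∈ unitaryGroup (Fin n → Fin 2) ℂ :=
  tensorOp_mem_unitary fun k => pauli_mem_unitary (p k)

lemma pauliString_conjTranspose (p : Fin n → Fin 4) : (pauliString p)ᴴ = pauliString p := by
  simp [pauliString, tensorOp_conjTranspose, pauli_conjTranspose]

lemma pauliString_zero : pauliString (0 : Fin n → Fin 4) = 1 := by
  simp only [pauliString, Pi.zero_apply, pauli_zero]; exact tensorOp_one

lemma sum_pauliString_entries (a b c d : Fin n → Fin 2) :
    ∑ p, pauliString p a b * pauliString p c d = if a = d ∧ b = c then 2 ^ n else 0 := by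
  simp only [pauliString, tensorOp, ← Finset.prod_mul_distrib]
  have h := Finset.prod_univ_sum (fun _ : Fin n => (Finset.univ : Finset (Fin 4)))
    (fun k p => pauli p (a k) (b k) * pauli p (c k) (d k))
  rw [Fintype.piFinset_univ] at h
  rw [← h]
  simp only [sum_pauli_entries]
  rw [Finset.prod_ite_zero]
  simp [funext_iff, forall_and]

/-- The coefficient of an operator at a Pauli string. -/
def pauliCoeff (X : QOp n) (p : Fin n → Fin 4) : ℂ := (2 ^ n)⁻¹ * (pauliString p * X).trace

lemma trace_mul_eq_sum {ι : Type} [Fintype ι] (A B : Matrix ι ι ℂ) :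
    (A * B).trace = ∑ a, ∑ b, A a b * B b a := by
  simp [trace, mul_apply]

lemma sum_pauliCoeff_smul (X : QOp n) : ∑ p, pauliCoeff X p • pauliString p = X := by
  ext a b
  simp only [pauliCoeff, trace_mul_eq_sum, Matrix.sum_apply, Matrix.smul_apply, smul_eq_mul]
  have : ∀ p, ((2 ^ n)⁻¹ * ∑ c, ∑ d, pauliString p c d * X d c) * pauliString p a b =
      (2 ^ n)⁻¹ * ∑ c, ∑ d, X d c * (pauliString p c d * pauliString p a b) := by
    intro p
    rw [mul_assoc, Finset.sum_mul]
    congr 1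
    refine Finset.sum_congr rfl fun c _ => ?_
    rw [Finset.sum_mul]
    refine Finset.sum_congr rfl fun d _ => ?_
    ring
  simp only [this]
  rw [← Finset.mul_sum, Finset.sum_comm]
  simp only [Finset.sum_comm (s := Finset.univ (α := Fin n → Fin 4)), ← Finset.mul_sum,
    sum_pauliString_entries]
  simp only [ite_and, mul_ite, mul_zero]
  simp
  field_simp

/-- Parseval's identity for the Pauli basis, again from completeness. -/
lemma sum_norm_sq_pauliCoeff (X : QOp n) :
    ∑ p, ‖pauliCoeff X p‖ ^ 2 = (2 ^ n)⁻¹ * ∑ a, ∑ b, ‖X a b‖ ^ 2 := by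
  have key : ∑ p, (pauliString p * X).trace * star (pauliString p * X).trace =
      2 ^ n * ∑ a, ∑ b, X a b * star (X a b) := by
    have h1 : ∀ p : Fin n → Fin 4, (pauliString p * X).trace * star (pauliString p * X).trace =
        ∑ a, ∑ b, ∑ c, ∑ d, X d c * star (X b a) * (pauliString p c d * pauliString p b a) := by
      intro p
      rw [trace_mul_eq_sum, star_sum]
      simp only [star_sum, Finset.sum_mul, Finset.mul_sum]
      refine Finset.sum_congr rfl fun a _ => Finset.sum_congr rfl fun b _ =>
        Finset.sum_congr rfl fun c _ => Finset.sum_congr rfl fun d _ => ?_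
      have : star (pauliString p a b) = pauliString p b a := by
        conv_rhs => rw [← pauliString_conjTranspose]
        rfl
      rw [star_mul', this]
      ring
    simp only [h1]
    rw [Finset.sum_comm]
    simp only [Finset.sum_comm (s := Finset.univ (α := Fin n → Fin 4)), ← Finset.mul_sum,
      sum_pauliString_entries]
    simp only [ite_and, mul_ite, mul_zero]
    rw [Finset.sum_comm, Finset.mul_sum]
    refine Finset.sum_congr rfl fun a _ => ?_
    rw [Finset.mul_sum]
    refine Finset.sum_congr rfl fun b _ => ?_
    simp
    ring
  have h2 : ((∑ p, ‖pauliCoeff X p‖ ^ 2 : ℝ) : ℂ) =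
      (((2 ^ n)⁻¹ * ∑ a, ∑ b, ‖X a b‖ ^ 2 : ℝ) : ℂ) := by
    push_cast
    simp only [← Complex.mul_conj'] at *
    have h3 : ∀ p, pauliCoeff X p * (starRingEnd ℂ) (pauliCoeff X p) = (2 ^ n)⁻¹ * (2 ^ n)⁻¹ *
        ((pauliString p * X).trace * star (pauliString p * X).trace) := by
      intro p
      simp only [pauliCoeff, map_mul, map_inv₀, map_pow, Complex.conj_ofNat, Complex.star_def]
      ring
    simp only [h3, ← Finset.mul_sum, key]
    have : (2 : ℂ) ^ n ≠ 0 := by positivity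
    simp only [Complex.star_def]
    field_simp
  exact_mod_cast h2

/-- The normalized Frobenius norm is at most the operator norm. This closes the recursion over
layers, which is run in operator norm. -/
lemma sum_norm_sq_pauliCoeff_le (X : QOp n) : ∑ p, ‖pauliCoeff X p‖ ^ 2 ≤ ‖X‖ ^ 2 := by
  rw [sum_norm_sq_pauliCoeff]
  have h := sum_norm_sq_entry_le X
  simp only [Fintype.card_pi, Fintype.card_fin, Finset.prod_const, Finset.card_univ] at h
  push_cast at h
  rw [inv_mul_le_iff₀ (by positivity)]
  exact h

lemma pauliCoeff_zero (X : QOp n) (h : X.trace = 0) : pauliCoeff X 0 = 0 := by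
  simp [pauliCoeff, pauliString_zero, h]

lemma trace_pauliString_of_ne_zero {p : Fin n → Fin 4} (h : p ≠ 0) :
    (pauliString p).trace = 0 := by
  obtain ⟨k, hk⟩ := Function.ne_iff.mp h
  rw [pauliString, trace_tensorOp]
  exact Finset.prod_eq_zero (Finset.mem_univ k) (by rw [trace_pauli]; exact if_neg hk)

end pauli

/-! ### A finite single-qubit twirl -/

/-- The rotations by `0`, `2π/3`, `-2π/3` about the axis `(1, 1, 1)`. -/
def axisRot : Fin 3 → Op1 :=
  ![1, (1 / 2 : ℂ) • !![1 - Complex.I, -1 - Complex.I; 1 - Complex.I, 1 + Complex.I],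
    (1 / 2 : ℂ) • !![1 + Complex.I, 1 + Complex.I; -1 + Complex.I, 1 - Complex.I]]

/-- The action of the rotations `axisRot` on the letters `I, X, Y, Z`. -/
def axisPerm : Fin 3 → Fin 4 → Fin 4 := ![![0, 1, 2, 3], ![0, 3, 1, 2], ![0, 2, 3, 1]]

/-- The sign by which two Pauli matrices commute. -/
def pauliSign (q p : Fin 4) : ℝ := if q = 0 ∨ p = 0 ∨ q = p then 1 else -1

lemma axisRot_mem_unitary (j : Fin 3) : axisRot j ∈ unitaryGroup (Fin 2) ℂ := by
  rw [mem_unitaryGroup_iff, star_eq_conjTranspose]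
  ext a b
  fin_cases j <;> fin_cases a <;> fin_cases b <;>
    simp [axisRot, mul_apply, Fin.sum_univ_two, Complex.ext_iff] <;> norm_num

lemma axisRot_conj_pauli (j : Fin 3) (p : Fin 4) :
    (axisRot j)ᴴ * pauli p * axisRot j = pauli (axisPerm j p) := by
  ext a b
  fin_cases j <;> fin_cases p <;> fin_cases a <;> fin_cases b <;>
    simp [axisRot, axisPerm, pauli, mul_apply, Fin.sum_univ_two, Complex.ext_iff] <;> norm_num

lemma pauli_conj_pauli (q p : Fin 4) :
    pauli q * pauli p * pauli q = (pauliSign q p : ℂ) • pauli p := by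
  ext a b
  fin_cases q <;> fin_cases p <;> fin_cases a <;> fin_cases b <;>
    simp [pauliSign, pauli, mul_apply, Fin.sum_univ_two]

/-- For fixed `p`, the signs form a character of the Pauli group modulo phases, and these four
characters are orthogonal. -/
lemma sum_pauliSign_mul (p p' : Fin 4) :
    ∑ q, pauliSign q p * pauliSign q p' = if p = p' then 4 else 0 := by
  fin_cases p <;> fin_cases p' <;> simp [pauliSign, Fin.sum_univ_four] <;> norm_num

lemma axisPerm_eq_zero_iff (j : Fin 3) (p : Fin 4) : axisPerm j p = 0 ↔ p = 0 := by
  revert j p; decide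

lemma sum_axisPerm (m : Fin 4 → ℝ) (p : Fin 4) :
    ∑ j, m (axisPerm j p) = if p = 0 then 3 * m 0 else m 1 + m 2 + m 3 := by
  fin_cases p <;> simp [axisPerm, Fin.sum_univ_three] <;> ring

/-- The labels of the single-qubit unitaries used for twirling. -/
abbrev TwirlIndex : Type := Fin 4 × Fin 3

/-- The single-qubit unitaries used for twirling. -/
def twirlGate (a : TwirlIndex) : UGroup (Fin 2) :=
  ⟨pauli a.1 * axisRot a.2, mul_mem (pauli_mem_unitary _) (axisRot_mem_unitary _)⟩

/-- The tensor products of single-qubit unitaries used for twirling. -/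
def twirlOp {n : ℕ} (a : Fin n → TwirlIndex) : QOp n := tensorOp fun k => (twirlGate (a k) : Op1)

lemma twirlGate_conj_pauli (a : TwirlIndex) (p : Fin 4) :
    (twirlGate a : Op1)ᴴ * pauli p * (twirlGate a : Op1) =
      (pauliSign a.1 p : ℂ) • pauli (axisPerm a.2 p) := by
  have h : (twirlGate a : Op1)ᴴ * pauli p * (twirlGate a : Op1) =
      (axisRot a.2)ᴴ * (pauli a.1 * pauli p * pauli a.1) * axisRot a.2 := by
    simp [twirlGate, conjTranspose_mul, pauli_conjTranspose, Matrix.mul_assoc]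
  rw [h, pauli_conj_pauli, Matrix.mul_smul, Matrix.smul_mul, axisRot_conj_pauli]

lemma twirlOp_conj_pauliString {n : ℕ} (a : Fin n → TwirlIndex) (p : Fin n → Fin 4) :
    (twirlOp a)ᴴ * pauliString p * twirlOp a =
      ((∏ k, pauliSign (a k).1 (p k) : ℝ) : ℂ) • pauliString fun k => axisPerm (a k).2 (p k) := by
  rw [twirlOp, tensorOp_conjTranspose, pauliString, tensorOp_mul, tensorOp_mul]
  simp only [twirlGate_conj_pauli]
  rw [tensorOp_smul]
  push_cast
  rfl

lemma sum_prod_pauliSign {n : ℕ} (p p' : Fin n → Fin 4) :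
    ∑ q : Fin n → Fin 4, (∏ k, pauliSign (q k) (p k)) * ∏ k, pauliSign (q k) (p' k) =
      if p = p' then 4 ^ n else 0 := by
  simp only [← Finset.prod_mul_distrib]
  have h := Finset.prod_univ_sum (fun _ : Fin n => (Finset.univ : Finset (Fin 4)))
    (fun k q => pauliSign q (p k) * pauliSign q (p' k))
  rw [Fintype.piFinset_univ] at h
  rw [← h]
  simp only [sum_pauliSign_mul]
  rw [Finset.prod_ite_zero]
  simp [funext_iff]

/-- Averaging over signs removes the cross terms. -/
lemma sum_norm_sq_sum_pauliSign {n : ℕ} (z : (Fin n → Fin 4) → ℂ) :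
    ∑ q : Fin n → Fin 4, ‖∑ p, ((∏ k, pauliSign (q k) (p k) : ℝ) : ℂ) * z p‖ ^ 2 =
      4 ^ n * ∑ p, ‖z p‖ ^ 2 := by
  have h : ((∑ q : Fin n → Fin 4, ‖∑ p, ((∏ k, pauliSign (q k) (p k) : ℝ) : ℂ) * z p‖ ^ 2 : ℝ) : ℂ)
      = ((4 ^ n * ∑ p, ‖z p‖ ^ 2 : ℝ) : ℂ) := by
    rw [Complex.ofReal_sum]
    simp only [Complex.ofReal_mul, Complex.ofReal_sum, Complex.ofReal_pow, ← Complex.mul_conj',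
      map_sum, map_mul, Complex.conj_ofReal, Finset.sum_mul_sum]
    have h1 : ∀ (q p p' : Fin n → Fin 4),
        ((∏ k, pauliSign (q k) (p k) : ℝ) : ℂ) * z p *
          (((∏ k, pauliSign (q k) (p' k) : ℝ) : ℂ) * (starRingEnd ℂ) (z p')) =
        z p * (starRingEnd ℂ) (z p') *
          (((∏ k, pauliSign (q k) (p k)) * ∏ k, pauliSign (q k) (p' k) : ℝ) : ℂ) := by
      intro q p p'
      push_cast
      ring
    simp only [h1]
    rw [Finset.sum_comm, Finset.mul_sum]
    refine Finset.sum_congr rfl fun p _ => ?_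
    rw [Finset.sum_comm]
    simp only [← Finset.mul_sum, ← Complex.ofReal_sum, sum_prod_pauliSign]
    rw [Finset.sum_eq_single p]
    · simp; ring
    · intro b _ hb; simp [Ne.symm hb]
    · simp
  exact_mod_cast h

/-- The second moment of the twirl. -/
lemma sum_norm_sq_twirl {n : ℕ} (f : QOp n →ₗ[ℂ] ℂ) (X : QOp n) :
    ∑ a : Fin n → TwirlIndex, ‖f ((twirlOp a)ᴴ * X * twirlOp a)‖ ^ 2 =
      4 ^ n * ∑ j : Fin n → Fin 3, ∑ p,
        ‖pauliCoeff X p‖ ^ 2 * ‖f (pauliString fun k => axisPerm (j k) (p k))‖ ^ 2 := by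
  have h1 : ∀ a : Fin n → TwirlIndex, f ((twirlOp a)ᴴ * X * twirlOp a) =
      ∑ p, ((∏ k, pauliSign (a k).1 (p k) : ℝ) : ℂ) *
        (pauliCoeff X p * f (pauliString fun k => axisPerm (a k).2 (p k))) := by
    intro a
    conv_lhs => rw [← sum_pauliCoeff_smul X]
    rw [Finset.mul_sum, Finset.sum_mul, map_sum]
    refine Finset.sum_congr rfl fun p _ => ?_
    rw [Matrix.mul_smul, Matrix.smul_mul, twirlOp_conj_pauliString, map_smul, map_smul]
    simp only [smul_eq_mul]
    ring
  simp only [h1]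
  -- The labels are separated into Pauli part and rotation part; for fixed rotations the sum over
  -- the Pauli part is an orthogonality sum over signs.
  rw [← (Equiv.arrowProdEquivProdArrow (Fin n) (fun _ => Fin 4) (fun _ => Fin 3)).symm.sum_comp,
    Fintype.sum_prod_type_right, Finset.mul_sum]
  refine Finset.sum_congr rfl fun j _ => ?_
  simp only [Equiv.arrowProdEquivProdArrow, Equiv.coe_fn_symm_mk]
  rw [sum_norm_sq_sum_pauliSign (fun p => pauliCoeff X p *
    f (pauliString fun k => axisPerm (j k) (p k)))]
  simp [mul_pow]

/-- Averaging a product of single-letter weights over the rotations. -/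
lemma sum_prod_axisPerm {n : ℕ} (m : Fin 4 → ℝ) (h0 : m 0 = 1) (p : Fin n → Fin 4) :
    ∑ j : Fin n → Fin 3, ∏ k, m (axisPerm (j k) (p k)) =
      3 ^ n * ((m 1 + m 2 + m 3) / 3) ^ pauliWeight p := by
  have h := Finset.prod_univ_sum (fun _ : Fin n => (Finset.univ : Finset (Fin 3)))
    (fun k j => m (axisPerm j (p k)))
  rw [Fintype.piFinset_univ] at h
  rw [← h]
  simp only [sum_axisPerm, h0, mul_one]
  -- A factor `3` is taken out on every qubit, so that only the letters different from `I` carry the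
  -- mean of the three weights.
  have h2 : ∀ k, (if p k = 0 then (3 : ℝ) else m 1 + m 2 + m 3) =
      3 * if p k ≠ 0 then (m 1 + m 2 + m 3) / 3 else 1 := by
    intro k; split_ifs <;> field_simp; simp_all
  simp only [h2]
  rw [Finset.prod_mul_distrib, Finset.prod_ite]
  simp [pauliWeight, div_pow]

/-! ### Second moments of 2-designs -/

section design
variable {κ : Type} [Fintype κ] [DecidableEq κ]

instance isHaarMeasure_haarProb : (haarProb κ).IsHaarMeasure := by
  unfold haarProb; infer_instance

instance isProbabilityMeasure_haarProb : IsProbabilityMeasure (haarProb κ) :=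
  ⟨Measure.haarMeasure_self (K₀ := ⊤)⟩

instance secondCountableTopology_UGroup : SecondCountableTopology (UGroup κ) := by
  have : SecondCountableTopology (Matrix κ κ ℂ) :=
    inferInstanceAs (SecondCountableTopology (κ → κ → ℂ))
  exact TopologicalSpace.Subtype.secondCountableTopology _

/-- Unimodularity of a compact group: the right translate is again a Haar probability measure, and
there is only one. -/
lemma map_mul_right_haarProb (h : UGroup κ) : (haarProb κ).map (· * h) = haarProb κ := by
  have : IsProbabilityMeasure ((haarProb κ).map (· * h)) :=
    Measure.isProbabilityMeasure_map (by fun_prop)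
  exact Measure.isHaarMeasure_eq_of_isProbabilityMeasure _ _

lemma continuous_coe_UGroup : Continuous fun u : UGroup κ => (u : Matrix κ κ ℂ) :=
  continuous_subtype_val

/-- The monomials `U_{ax} conj(U_{by})` in the entries of a unitary matrix. -/
def entryMonomial (m : (κ × κ) × κ × κ) (u : UGroup κ) : ℂ :=
  (u : Matrix κ κ ℂ) m.1.1 m.1.2 * star ((u : Matrix κ κ ℂ) m.2.1 m.2.2)

lemma continuous_entryMonomial (m : (κ × κ) × κ × κ) : Continuous (entryMonomial m) := by
  have h := continuous_coe_UGroup (κ := κ)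
  unfold entryMonomial
  exact (h.matrix_elem _ _).mul (h.matrix_elem _ _).star

/-- Functions on the unitary group that are linear in `U ⊗ conj U`. -/
def IsSesquilinear (φ : UGroup κ → ℂ) : Prop :=
  ∃ k : (κ × κ) × κ × κ → ℂ, ∀ u, φ u = ∑ m, k m * entryMonomial m u

lemma IsSesquilinear.continuous {φ : UGroup κ → ℂ} (h : IsSesquilinear φ) : Continuous φ := by
  obtain ⟨k, hk⟩ := h
  rw [funext hk]
  exact continuous_finsetSum _ fun m _ => continuous_const.mul (continuous_entryMonomial m)

/-- This is the form in which a circuit depends on one of its random gates: `E` embeds the gate into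
the register and `f` collects everything that happens afterwards. -/
lemma isSesquilinear_conjMap {ι : Type} [Fintype ι] (E : Matrix κ κ ℂ →ₗ[ℂ] Matrix ι ι ℂ)
    (f : Matrix ι ι ℂ →ₗ[ℂ] ℂ) (σ : Matrix ι ι ℂ) :
    IsSesquilinear fun u : UGroup κ => f (conjMap (E (u : Matrix κ κ ℂ)) σ) := by
  refine ⟨fun m => f (E (single m.1.1 m.1.2 1) * σ * (E (single m.2.1 m.2.2 1))ᴴ), fun u => ?_⟩
  have h : E (u : Matrix κ κ ℂ) =
      ∑ m : κ × κ, (u : Matrix κ κ ℂ) m.1 m.2 • E (single m.1 m.2 1) := by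
    conv_lhs => rw [matrix_eq_sum_single (u : Matrix κ κ ℂ)]
    rw [Fintype.sum_prod_type, map_sum]
    refine Finset.sum_congr rfl fun a _ => ?_
    rw [map_sum]
    refine Finset.sum_congr rfl fun b _ => ?_
    rw [← map_smul, smul_single, smul_eq_mul, mul_one]
  dsimp only
  rw [conjMap_apply, h, conjTranspose_sum, ← Finset.univ_product_univ (α := κ × κ) (β := κ × κ),
    Finset.sum_product, Finset.sum_mul, Finset.sum_mul, map_sum]
  refine Finset.sum_congr rfl fun a _ => ?_
  rw [Finset.mul_sum, map_sum]
  refine Finset.sum_congr rfl fun b _ => ?_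
  rw [conjTranspose_smul, Matrix.smul_mul, Matrix.smul_mul, Matrix.mul_smul, map_smul, map_smul]
  simp only [entryMonomial, smul_eq_mul]
  ring

lemma IsSesquilinear.sum {α : Type} (s : Finset α) (c : α → ℂ) (φ : α → UGroup κ → ℂ)
    (h : ∀ i, IsSesquilinear (φ i)) : IsSesquilinear fun u => ∑ i ∈ s, c i * φ i u := by
  choose k hk using h
  refine ⟨fun m => ∑ i ∈ s, c i * k i m, fun u => ?_⟩
  simp only [hk, Finset.mul_sum, Finset.sum_mul, mul_assoc]
  rw [Finset.sum_comm]

lemma IsSesquilinear.comp_mul_right {φ : UGroup κ → ℂ} (hφ : IsSesquilinear φ) (h : UGroup κ) :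
    IsSesquilinear fun u => φ (u * h) := by
  obtain ⟨k, hk⟩ := hφ
  simp only [hk]
  refine IsSesquilinear.sum _ _ (fun m u => entryMonomial m (u * h)) fun m => ?_
  -- A monomial in the entries of `u * h` is an entry of `(u * h) * E * (u * h)ᴴ` for a matrix unit
  -- `E`.
  have h1 := isSesquilinear_conjMap (LinearMap.mulRight ℂ (h : Matrix κ κ ℂ))
    (entryLinearMap ℂ ℂ m.1.1 m.2.1) (single m.1.2 m.2.2 1)
  convert! h1 using 2 with u
  rw [conjMap_apply, entryLinearMap_apply, mul_apply, Finset.sum_eq_single m.2.2]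
  · rw [mul_single_apply_same]
    simp [entryMonomial]
  · intro b _ hb
    rw [mul_single_apply_of_ne _ _ _ _ _ hb, zero_mul]
  · simp

/-- Products of two entries and two conjugate entries are what the 2-design condition controls, with
a matrix unit in the place of `O`. -/
lemma entryMonomial_mul_star (m m' : (κ × κ) × κ × κ) (u : UGroup κ) :
    entryMonomial m u * star (entryMonomial m' u) =
      (((u : Matrix κ κ ℂ) ⊗ₖ (u : Matrix κ κ ℂ)) *
        (single (m.1.2, m'.2.2) (m.2.2, m'.1.2) 1 : Matrix (κ × κ) (κ × κ) ℂ) *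
        ((u : Matrix κ κ ℂ) ⊗ₖ (u : Matrix κ κ ℂ)).conjTranspose) (m.1.1, m'.2.1)
          (m.2.1, m'.1.1) := by
  rw [mul_apply, Finset.sum_eq_single (m.2.2, m'.1.2)]
  · rw [mul_single_apply_same]
    simp only [entryMonomial, kroneckerMap_apply, conjTranspose_apply, star_mul', star_star]
    ring
  · intro b _ hb
    rw [mul_single_apply_of_ne _ _ _ _ _ hb, zero_mul]
  · simp

lemma integral_norm_sq_eq_haarProb {ν : Measure (UGroup κ)} [IsProbabilityMeasure ν]
    (hν : IsTwoDesign ν) {φ : UGroup κ → ℂ} (hφ : IsSesquilinear φ) :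
    ∫ u, ‖φ u‖ ^ 2 ∂ν = ∫ u, ‖φ u‖ ^ 2 ∂(haarProb κ) := by
  obtain ⟨k, hk⟩ := hφ
  have h1 : ∀ u, ((‖φ u‖ ^ 2 : ℝ) : ℂ) =
      ∑ m, ∑ m', k m * star (k m') * (entryMonomial m u * star (entryMonomial m' u)) := by
    intro u
    push_cast
    rw [← Complex.mul_conj', hk, map_sum, Finset.sum_mul_sum]
    refine Finset.sum_congr rfl fun m _ => Finset.sum_congr rfl fun m' _ => ?_
    rw [map_mul]
    simp only [Complex.star_def]
    ring
  have h2 : ∀ (τ : Measure (UGroup κ)) [IsProbabilityMeasure τ], ((∫ u, ‖φ u‖ ^ 2 ∂τ : ℝ) : ℂ) =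
      ∑ m, ∑ m', k m * star (k m') * ∫ u, entryMonomial m u * star (entryMonomial m' u) ∂τ := by
    intro τ _
    have hc : ∀ m m' : (κ × κ) × κ × κ,
        Continuous fun u => entryMonomial m u * star (entryMonomial m' u) := fun m m' =>
      (continuous_entryMonomial m).mul (continuous_entryMonomial m').star
    have hi : ∀ m m' : (κ × κ) × κ × κ,
        Integrable (fun u => k m * star (k m') * (entryMonomial m u * star (entryMonomial m' u))) τ :=
      fun m m' => ((continuous_const.mul (hc m m')).integrable_of_hasCompactSupport
        (HasCompactSupport.of_compactSpace _))
    rw [← integral_complex_ofReal]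
    simp only [h1]
    rw [integral_finsetSum _ fun m _ => integrable_finsetSum _ fun m' _ => hi m m']
    refine Finset.sum_congr rfl fun m _ => ?_
    rw [integral_finsetSum _ fun m' _ => hi m m']
    refine Finset.sum_congr rfl fun m' _ => ?_
    rw [integral_const_mul]
  have h3 : ((∫ u, ‖φ u‖ ^ 2 ∂ν : ℝ) : ℂ) = ((∫ u, ‖φ u‖ ^ 2 ∂(haarProb κ) : ℝ) : ℂ) := by
    rw [h2, h2]
    refine Finset.sum_congr rfl fun m _ => Finset.sum_congr rfl fun m' _ => ?_
    simp only [entryMonomial_mul_star]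
    rw [hν]
  exact_mod_cast h3

/-- A 2-design need not be invariant itself, but both sides agree with their Haar values, and Haar
measure is right-invariant. -/
lemma lintegral_norm_sq_mul_right {ν : Measure (UGroup κ)} [IsProbabilityMeasure ν]
    (hν : IsTwoDesign ν) {φ : UGroup κ → ℂ} (hφ : IsSesquilinear φ) (h : UGroup κ) :
    ∫⁻ u, ENNReal.ofReal (‖φ (u * h)‖ ^ 2) ∂ν = ∫⁻ u, ENNReal.ofReal (‖φ u‖ ^ 2) ∂ν := by
  have key : ∀ {ψ : UGroup κ → ℂ}, IsSesquilinear ψ →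
      ∫⁻ u, ENNReal.ofReal (‖ψ u‖ ^ 2) ∂ν = ENNReal.ofReal (∫ u, ‖ψ u‖ ^ 2 ∂(haarProb κ)) := by
    intro ψ hψ
    rw [← integral_norm_sq_eq_haarProb hν hψ, ofReal_integral_eq_lintegral_ofReal]
    · exact (hψ.continuous.norm.pow 2).integrable_of_hasCompactSupport
        (HasCompactSupport.of_compactSpace _)
    · exact Filter.Eventually.of_forall fun u => by positivity
  rw [key hφ, key (hφ.comp_mul_right h)]
  congr 1
  conv_rhs => rw [← map_mul_right_haarProb h]
  rw [integral_map (by fun_prop)]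
  exact (hφ.continuous.norm.pow 2).aestronglyMeasurable

/-- Second moments are invariant under right translations in the coordinates whose laws are
2-designs. -/
lemma lintegral_pi_norm_sq_mul_right {ι : Type} [Fintype ι] [DecidableEq ι]
    (ν : ι → Measure (UGroup κ)) [∀ i, IsProbabilityMeasure (ν i)]
    (Z : (ι → UGroup κ) → ℂ) (hZ : Continuous Z) (η : ι → UGroup κ)
    (hη : ∀ i, η i = 1 ∨ IsTwoDesign (ν i) ∧
      ∀ ω, IsSesquilinear fun u => Z (Function.update ω i u)) :
    ∫⁻ ω, ENNReal.ofReal (‖Z (ω * η)‖ ^ 2) ∂(Measure.pi ν) =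
      ∫⁻ ω, ENNReal.ofReal (‖Z ω‖ ^ 2) ∂(Measure.pi ν) := by
  classical
  have hm : ∀ ζ : ι → UGroup κ, Measurable fun ω => ENNReal.ofReal (‖Z (ω * ζ)‖ ^ 2) := fun ζ =>
    (((hZ.comp (continuous_mul_const ζ)).norm.pow 2).measurable).ennreal_ofReal
  -- The coordinates are translated one at a time; each step compares marginals over a single
  -- coordinate.
  have key : ∀ S : Finset ι,
      ∫⁻ ω, ENNReal.ofReal (‖Z (ω * fun i => if i ∈ S then η i else 1)‖ ^ 2) ∂(Measure.pi ν) =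
      ∫⁻ ω, ENNReal.ofReal (‖Z ω‖ ^ 2) ∂(Measure.pi ν) := by
    intro S
    induction S using Finset.induction_on with
    | empty =>
      refine lintegral_congr fun ω => ?_
      have : (fun i => if i ∈ (∅ : Finset ι) then η i else 1) = 1 := by funext i; simp
      rw [this, mul_one]
    | insert i S hi ih =>
      rw [← ih]
      refine lintegral_eq_of_lmarginal_eq {i} (hm _) (hm _) ?_
      funext ω
      rw [lmarginal_singleton, lmarginal_singleton]
      set ζ : ι → UGroup κ := fun j => if j ∈ S then η j else 1 with hζ
      have h1 : ∀ u, Function.update ω i u * ζ = Function.update (ω * ζ) i u := by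
        intro u; funext j
        by_cases hj : j = i
        · subst hj; simp [hζ, hi]
        · simp [hj]
      have h2 : ∀ u, (Function.update ω i u * fun j => if j ∈ insert i S then η j else 1) =
          Function.update (ω * ζ) i (u * η i) := by
        intro u; funext j
        by_cases hj : j = i
        · subst hj; simp
        · simp [hj, hζ]
      simp only [h1, h2]
      rcases hη i with h | ⟨h, h'⟩
      · simp [h]
      · exact lintegral_norm_sq_mul_right h (h' (ω * ζ)) (η i)
  have := key Finset.univ
  simpa using this

end design

/-! ### Single-qubit channels -/

/-- The square of the Frobenius norm. -/
def frobSq {ι : Type} [Fintype ι] (M : Matrix ι ι ℂ) : ℝ := ∑ i, ∑ j, ‖M i j‖ ^ 2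

section frob
variable {ι : Type} [Fintype ι]

lemma frobSq_nonneg (M : Matrix ι ι ℂ) : 0 ≤ frobSq M := by
  unfold frobSq; positivity

lemma ofReal_frobSq (M : Matrix ι ι ℂ) : (frobSq M : ℂ) = (M * Mᴴ).trace := by
  simp only [frobSq, trace_mul_eq_sum, conjTranspose_apply]
  push_cast
  simp [← Complex.mul_conj']

lemma frobSq_unitary_conj [DecidableEq ι] {U : Matrix ι ι ℂ} (hU : U ∈ unitaryGroup ι ℂ)
    (M : Matrix ι ι ℂ) : frobSq (U * M * Uᴴ) = frobSq M := by
  have h : ((frobSq (U * M * Uᴴ) : ℝ) : ℂ) = (frobSq M : ℂ) := by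
    have h1 : Uᴴ * U = 1 := mem_unitaryGroup_iff'.mp hU
    have h2 : U * M * Uᴴ * (U * M * Uᴴ)ᴴ = U * (M * Mᴴ) * Uᴴ := by
      simp only [conjTranspose_mul, conjTranspose_conjTranspose, Matrix.mul_assoc]
      rw [← Matrix.mul_assoc Uᴴ U, h1, Matrix.one_mul]
    rw [ofReal_frobSq, ofReal_frobSq, h2, trace_mul_comm, ← Matrix.mul_assoc, h1, Matrix.one_mul]
  exact_mod_cast h

lemma frobSq_of_mem_unitary [DecidableEq ι] {U : Matrix ι ι ℂ} (hU : U ∈ unitaryGroup ι ℂ) :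
    frobSq U = Fintype.card ι := by
  have h : ((frobSq U : ℝ) : ℂ) = ((Fintype.card ι : ℝ) : ℂ) := by
    rw [ofReal_frobSq, ← star_eq_conjTranspose, mem_unitaryGroup_iff.mp hU]
    simp
  exact_mod_cast h

lemma sum_norm_sq_trace_pauli_mul (M : Op1) :
    ∑ r, ‖(pauli r * M).trace‖ ^ 2 = 2 * frobSq M := by
  simp only [frobSq, Fin.sum_univ_four, Fin.sum_univ_two, trace_fin_two, mul_apply,
    ← Complex.normSq_eq_norm_sq, Complex.normSq_apply]
  simp [pauli]
  ring

end frob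

section channel
variable {N : Op1 →ₗ[ℂ] Op1}

/-- The Choi matrix. -/
def choi (N : Op1 →ₗ[ℂ] Op1) : Matrix (Fin 2 × Fin 2) (Fin 2 × Fin 2) ℂ :=
  fun x y => N (single x.2 y.2 1) x.1 y.1

/-- The Choi matrix is the ampliation of the channel applied to the unnormalized maximally entangled
state `v v†`. -/
lemma choi_posSemidef (hN : IsChannel N) : (choi N).PosSemidef := by
  let v : Fin 2 × Fin 2 → ℂ := fun x => if x.1 = x.2 then 1 else 0
  have h := hN.1 2 _ (posSemidef_vecMulVec_self_star v)
  convert h using 1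
  ext x y
  have h1 : single x.2 y.2 (1 : ℂ) = of fun i j => vecMulVec v (star v) (i, x.2) (j, y.2) := by
    ext i j
    simp only [single_apply, vecMulVec_apply, v, Pi.star_apply, ite_and, of_apply]
    by_cases h1 : i = x.2 <;> by_cases h2 : j = y.2 <;> simp [h1, h2, eq_comm]
  rw [choi, h1]
  rfl

lemma channel_single_conjTranspose (hN : IsChannel N) (a b : Fin 2) :
    (N (single a b 1))ᴴ = N (single b a 1) := by
  ext i j
  have h := (choi_posSemidef hN).isHermitian.apply (i, b) (j, a)
  exact h

/-- The Heisenberg picture image of the Pauli matrix `pauli r`. -/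
def heisenberg (N : Op1 →ₗ[ℂ] Op1) (r : Fin 4) : Op1 :=
  fun b a => (pauli r * N (single a b 1)).trace

lemma trace_heisenberg_mul (N : Op1 →ₗ[ℂ] Op1) (r : Fin 4) (A : Op1) :
    (heisenberg N r * A).trace = (pauli r * N A).trace := by
  conv_rhs => rw [matrix_eq_sum_single A]
  have h : ∀ a b, single a b (A a b) = A a b • single a b (1 : ℂ) := by
    intro a b; rw [smul_single, smul_eq_mul, mul_one]
  simp only [h, map_sum, map_smul, Finset.mul_sum, trace_sum, Matrix.mul_smul, trace_smul]
  rw [trace_mul_eq_sum, Finset.sum_comm]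
  simp only [heisenberg, smul_eq_mul]
  refine Finset.sum_congr rfl fun a _ => Finset.sum_congr rfl fun b _ => ?_
  ring

/-- Trace preservation is unitality of the dual map. -/
lemma heisenberg_zero (hN : IsChannel N) : heisenberg N 0 = 1 := by
  ext b a
  rw [heisenberg, pauli_zero, Matrix.one_mul, hN.2, one_apply]
  by_cases h : a = b
  · subst h; simp
  · rw [trace_single_eq_of_ne _ _ _ h, if_neg (Ne.symm h)]

lemma heisenberg_conjTranspose (hN : IsChannel N) (r : Fin 4) :
    (heisenberg N r)ᴴ = heisenberg N r := by
  ext b a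
  simp only [conjTranspose_apply, heisenberg]
  rw [← trace_conjTranspose, conjTranspose_mul, channel_single_conjTranspose hN,
    pauli_conjTranspose, trace_mul_comm]

lemma trace_heisenberg (hunital : IsUnital N) {r : Fin 4} (hr : r ≠ 0) :
    (heisenberg N r).trace = 0 := by
  have h := trace_heisenberg_mul N r 1
  rw [hunital, Matrix.mul_one, Matrix.mul_one, trace_pauli, if_neg hr] at h
  exact h

/-- The squared length of the Heisenberg picture image of a Pauli matrix. -/
def lengthSq (N : Op1 →ₗ[ℂ] Op1) (r : Fin 4) : ℝ := frobSq (heisenberg N r) / 2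

lemma lengthSq_nonneg (N : Op1 →ₗ[ℂ] Op1) (r : Fin 4) : 0 ≤ lengthSq N r :=
  div_nonneg (frobSq_nonneg _) (by norm_num)

lemma lengthSq_zero (hN : IsChannel N) : lengthSq N 0 = 1 := by
  rw [lengthSq, heisenberg_zero hN, frobSq_of_mem_unitary (one_mem _)]
  simp

/-- Cayley–Hamilton for a traceless two-by-two matrix. -/
lemma mul_self_of_trace_eq_zero {M : Op1} (h : M.trace = 0) :
    M * M = ((M * M).trace / 2) • (1 : Op1) := by
  rw [trace_fin_two] at h
  have h4 : M 1 1 = - M 0 0 := by linear_combination h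
  refine Matrix.ext fun i j => ?_
  rw [Matrix.smul_apply, trace_fin_two]
  simp only [mul_apply, Fin.sum_univ_two, h4]
  fin_cases i <;> fin_cases j <;> simp [h4] <;> ring

/-- For `r ≠ 0` unitality makes the image traceless; being Hermitian, it then has a scalar square.
So no loss occurs between its operator norm and its normalized Frobenius norm. -/
lemma heisenberg_mul_conjTranspose (hN : IsChannel N) (hunital : IsUnital N) (r : Fin 4) :
    heisenberg N r * (heisenberg N r)ᴴ = (lengthSq N r : ℂ) • (1 : Op1) := by
  rcases eq_or_ne r 0 with hr | hr
  · rw [hr, lengthSq_zero hN, heisenberg_zero hN, conjTranspose_one, Matrix.mul_one,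
      Complex.ofReal_one, one_smul]
  · have h1 := heisenberg_conjTranspose hN r
    have h2 := mul_self_of_trace_eq_zero (trace_heisenberg hunital hr)
    have h3 : (lengthSq N r : ℂ) = (heisenberg N r * (heisenberg N r)ᴴ).trace / 2 := by
      rw [lengthSq, Complex.ofReal_div, ofReal_frobSq, Complex.ofReal_ofNat]
    rw [h3, h1]
    exact h2

/-- The mean squared contraction factor of a channel on the traceless operators. -/
def contraction (N : Op1 →ₗ[ℂ] Op1) : ℝ := (lengthSq N 1 + lengthSq N 2 + lengthSq N 3) / 3

lemma contraction_nonneg (N : Op1 →ₗ[ℂ] Op1) : 0 ≤ contraction N :=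
  div_nonneg (add_nonneg (add_nonneg (lengthSq_nonneg N 1) (lengthSq_nonneg N 2))
    (lengthSq_nonneg N 3)) (by norm_num)

lemma one_add_contraction (hN : IsChannel N) :
    1 + 3 * contraction N = ∑ a, ∑ b, (∑ r, ‖(pauli r * N (single a b 1)).trace‖ ^ 2) / 2 := by
  have h : 1 + 3 * contraction N = ∑ r, lengthSq N r := by
    rw [contraction, Fin.sum_univ_four, lengthSq_zero hN]; ring
  rw [h]
  simp only [lengthSq, frobSq, heisenberg, ← Finset.sum_div]
  congr 1
  simp only [Fin.sum_univ_two, Fin.sum_univ_four]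
  ring

/-- The summand `1` is the contribution of the letter `I`; Parseval in the output index turns the
sum over letters into a sum over matrix entries. -/
lemma one_add_contraction_eq_frobSq_choi (hN : IsChannel N) :
    1 + 3 * contraction N = frobSq (choi N) := by
  rw [one_add_contraction hN]
  simp only [sum_norm_sq_trace_pauli_mul, frobSq, choi, Fintype.sum_prod_type, Fin.sum_univ_two]
  ring

lemma frobSq_eq_sum_eigenvalues_sq {ι : Type} [Fintype ι] [DecidableEq ι] {J : Matrix ι ι ℂ}
    (hJ : J.IsHermitian) : frobSq J = ∑ i, hJ.eigenvalues i ^ 2 := by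
  have h := hJ.spectral_theorem
  rw [Unitary.conjStarAlgAut_apply] at h
  conv_lhs => rw [h]
  rw [star_eq_conjTranspose, frobSq_unitary_conj hJ.eigenvectorUnitary.2, frobSq]
  refine Finset.sum_congr rfl fun i _ => ?_
  rw [Finset.sum_eq_single i]
  · simp
  · intro j _ hj; simp [diagonal_apply_ne' _ hj]
  · simp

lemma sum_eigenvalues_choi (hN : IsChannel N) :
    ∑ x, (choi_posSemidef hN).isHermitian.eigenvalues x = 2 := by
  have h : (choi N).trace = 2 := by
    have h0 : ∀ a, (N (single a a 1)).trace = 1 := fun a => by rw [hN.2]; simp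
    have h1 := h0 0
    have h2 := h0 1
    rw [trace_fin_two] at h1 h2
    simp only [trace, diag_apply, choi, Fintype.sum_prod_type, Fin.sum_univ_two]
    linear_combination h1 + h2
  rw [(choi_posSemidef hN).isHermitian.trace_eq_sum_eigenvalues] at h
  simpa using congrArg Complex.re h

/-- The eigenvalues of the Choi matrix are nonnegative with sum `2`, so the sum of their squares is
at most `4`. -/
lemma contraction_le_one (hN : IsChannel N) : contraction N ≤ 1 := by
  have h1 := one_add_contraction_eq_frobSq_choi hN
  rw [frobSq_eq_sum_eigenvalues_sq (choi_posSemidef hN).isHermitian] at h1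
  have h2 := Finset.sum_sq_le_sq_sum_of_nonneg (s := Finset.univ)
    (f := (choi_posSemidef hN).isHermitian.eigenvalues)
    fun i _ => (choi_posSemidef hN).eigenvalues_nonneg i
  rw [sum_eigenvalues_choi hN] at h2
  linarith

lemma isUnitaryChannel_of_kraus (hN : IsChannel N) (K : Op1)
    (hK : ∀ a b, N (single a b 1) = K * single a b 1 * Kᴴ) : IsUnitaryChannel N := by
  have hA : ∀ A, N A = K * A * Kᴴ := by
    intro A
    have h : N = conjMap K := by
      apply Matrix.ext_linearMap
      intro a b
      ext1
      simp [hK]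
    rw [h, conjMap_apply]
  -- Trace preservation, tested on the matrix units, gives the entries of `Kᴴ * K`.
  have hKK : Kᴴ * K = 1 := by
    ext a b
    have h := hN.2 (single b a 1)
    rw [hA, Matrix.mul_assoc, trace_mul_comm, Matrix.mul_assoc, trace_mul_comm] at h
    rw [trace_mul_single] at h
    rw [op_smul_eq_mul, mul_one] at h
    rw [h, one_apply]
    by_cases hab : a = b
    · subst hab; simp
    · rw [trace_single_eq_of_ne _ _ _ (Ne.symm hab), if_neg hab]
  exact ⟨⟨K, mem_unitaryGroup_iff'.mpr hKK⟩, hA⟩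

/-- If the constant were `1`, the eigenvalues of the Choi matrix would have sum `2` and squares with
sum `4`. One eigenvalue is then `2` and the rest vanish, which leaves a single Kraus operator. -/
lemma contraction_lt_one (hN : IsChannel N) (hU : ¬ IsUnitaryChannel N) : contraction N < 1 := by
  refine lt_of_le_of_ne (contraction_le_one hN) fun hc => hU ?_
  set hJ := (choi_posSemidef hN).isHermitian with hJdef
  have h1 := one_add_contraction_eq_frobSq_choi hN
  rw [frobSq_eq_sum_eigenvalues_sq hJ, hc] at h1
  have h2 := sum_eigenvalues_choi hN
  rw [← hJdef] at h2
  have h0 : ∀ i, 0 ≤ hJ.eigenvalues i := (choi_posSemidef hN).eigenvalues_nonneg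
  have hle : ∀ i, hJ.eigenvalues i ≤ 2 := fun i => h2 ▸
    Finset.single_le_sum (fun j _ => h0 j) (Finset.mem_univ i)
  -- These nonnegative terms add up to `2 * 2 - 4 = 0`.
  have h3 : ∀ i, hJ.eigenvalues i * (2 - hJ.eigenvalues i) = 0 := by
    have h4 : ∑ i, hJ.eigenvalues i * (2 - hJ.eigenvalues i) = 0 := by
      simp only [mul_sub, Finset.sum_sub_distrib, ← Finset.sum_mul, h2, ← sq]
      linarith
    intro i
    exact (Finset.sum_eq_zero_iff_of_nonneg fun j _ =>
      mul_nonneg (h0 j) (by linarith [hle j])).mp h4 i (Finset.mem_univ i)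
  obtain ⟨x, hx⟩ : ∃ x, hJ.eigenvalues x = 2 := by
    by_contra hne
    push Not at hne
    have : ∀ i, hJ.eigenvalues i = 0 := fun i => by
      rcases mul_eq_zero.mp (h3 i) with h | h
      · exact h
      · exact absurd (by linarith) (hne i)
    simp [this] at h2
  have hz : ∀ y, y ≠ x → hJ.eigenvalues y = 0 := by
    intro y hy
    have h5 : hJ.eigenvalues x + hJ.eigenvalues y ≤ 2 := by
      rw [← h2, ← Finset.sum_pair hy.symm]
      exact Finset.sum_le_sum_of_subset_of_nonneg (Finset.subset_univ _) fun i _ _ => h0 i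
    linarith [h0 y]
  set W : Matrix (Fin 2 × Fin 2) (Fin 2 × Fin 2) ℂ :=
    (hJ.eigenvectorUnitary : Matrix (Fin 2 × Fin 2) (Fin 2 × Fin 2) ℂ)
  have h6 : ∀ p q, choi N p q = 2 * W p x * star (W q x) := by
    intro p q
    have h := hJ.spectral_theorem
    rw [Unitary.conjStarAlgAut_apply] at h
    conv_lhs => rw [h]
    rw [mul_apply, Finset.sum_eq_single x]
    · rw [mul_diagonal]
      simp only [Function.comp_apply, hx, W, star_apply]
      push_cast
      ring
    · intro y _ hy
      rw [mul_diagonal]; simp [hz y hy]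
    · simp
  -- The Kraus operator is the eigenvector of eigenvalue `2`, scaled by `√2` and reshaped into a
  -- matrix.
  refine isUnitaryChannel_of_kraus hN (of fun i a => (Real.sqrt 2 : ℂ) * W (i, a) x) fun a b => ?_
  ext i j
  have h7 := h6 (i, a) (j, b)
  simp only [choi] at h7
  have h8 : (Real.sqrt 2 : ℂ) * (Real.sqrt 2 : ℂ) = 2 := by
    rw [← Complex.ofReal_mul, Real.mul_self_sqrt (by norm_num)]; norm_num
  rw [h7, mul_apply, Finset.sum_eq_single b]
  · rw [mul_single_apply_same]
    simp only [conjTranspose_apply, of_apply, star_mul', Complex.star_def, Complex.conj_ofReal]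
    rw [← h8]
    ring
  · intro c _ hc
    rw [mul_single_apply_of_ne _ _ _ _ _ hc, zero_mul]
  · simp

/-- The noise constant of a unital channel does not depend on the normal form. -/
lemma noiseConst_eq_contraction (hN : IsChannel N) (hunital : IsUnital N)
    {t D : EuclideanSpace ℝ (Fin 3)} (h : IsNormalForm N t D) :
    noiseConst t D = contraction N := by
  obtain ⟨U, V, N', h1, hq, hA⟩ := h
  have hVV : (V : Op1)ᴴ * (V : Op1) = 1 := mem_unitaryGroup_iff'.mp V.2
  have hUU : (U : Op1)ᴴ * (U : Op1) = 1 := mem_unitaryGroup_iff'.mp U.2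
  have hN1 : N' 1 = 1 := by
    have h2 := hA 1
    rw [hunital, Matrix.mul_one, hVV] at h2
    calc N' 1 = ((U : Op1)ᴴ * U) * N' 1 * ((U : Op1)ᴴ * U) := by rw [hUU]; simp
      _ = (U : Op1)ᴴ * (U * N' 1 * (U : Op1)ᴴ) * U := by simp only [Matrix.mul_assoc]
      _ = 1 := by rw [← h2, Matrix.mul_one, hUU]
  -- Unitality forces `N' 1 = 1`, and the Pauli matrices are linearly independent.
  have ht : t = 0 := by
    rw [hN1] at h1
    have h2 : ∑ q : Fin 3, (t q : ℂ) • pauli q.succ = 0 := by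
      have := h1.symm; rwa [add_eq_left] at this
    have e1 := congrFun (congrFun h2 0) 0
    have e2 := congrFun (congrFun h2 0) 1
    simp [Fin.sum_univ_three, pauli, Complex.ext_iff] at e1 e2
    ext q
    fin_cases q
    · simpa using e2.1
    · simpa using e2.2
    · simpa using e1
  let d : Fin 4 → ℝ := Fin.cons 1 fun q => D q
  have hd : ∀ q, N' (pauli q) = (d q : ℂ) • pauli q := by
    intro q
    refine Fin.cases ?_ (fun q => ?_) q
    · simp [d, pauli_zero, hN1]
    · simp [d, hq]
  have hexp : ∀ B : Op1, B = ∑ q, ((pauli q * B).trace / 2) • pauli q := by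
    intro B
    ext i j
    fin_cases i <;> fin_cases j <;>
      simp [Fin.sum_univ_four, pauli, trace_fin_two, mul_apply] <;> ring_nf <;> simp <;> ring
  have htr : ∀ B q, (pauli q * N' B).trace = d q * (pauli q * B).trace := by
    intro B q
    have horth : ∀ q q', (pauli q * pauli q').trace = if q' = q then 2 else 0 := by
      intro q q'
      fin_cases q <;> fin_cases q' <;> simp [pauli, trace_fin_two] <;> norm_num
    conv_lhs => rw [hexp B]
    simp only [map_sum, map_smul, hd, Finset.mul_sum, Matrix.mul_smul, trace_sum, trace_smul,
      horth]
    simp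
    ring
  -- The outer unitary drops out of the Frobenius norm. The inner one only rotates Pauli matrices,
  -- whose squared Frobenius norm stays `2`.
  have hfin : 1 + 3 * contraction N = 1 + ‖D‖ ^ 2 := by
    rw [one_add_contraction hN]
    have h2 : ∀ a b, (∑ r, ‖(pauli r * N (single a b 1)).trace‖ ^ 2) / 2 =
        ∑ q, d q ^ 2 * ‖((V : Op1) * pauli q * (V : Op1)ᴴ) b a‖ ^ 2 / 2 := by
      intro a b
      rw [sum_norm_sq_trace_pauli_mul, hA, frobSq_unitary_conj U.2, ← sum_norm_sq_trace_pauli_mul,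
        Finset.sum_div]
      refine Finset.sum_congr rfl fun q _ => ?_
      rw [htr, norm_mul, mul_pow]
      have h3 : (pauli q * ((V : Op1)ᴴ * single a b 1 * (V : Op1))).trace =
          ((V : Op1) * pauli q * (V : Op1)ᴴ) b a := by
        rw [← Matrix.mul_assoc, trace_mul_comm, ← Matrix.mul_assoc, ← Matrix.mul_assoc,
          trace_mul_single]
        simp
      rw [h3]
      simp
    simp only [h2]
    have h4 : ∀ q, frobSq ((V : Op1) * pauli q * (V : Op1)ᴴ) = 2 := fun q => by
      rw [frobSq_unitary_conj V.2, frobSq_of_mem_unitary (pauli_mem_unitary q)]; simp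
    have h5 : ∑ a, ∑ b, ∑ q, d q ^ 2 * ‖((V : Op1) * pauli q * (V : Op1)ᴴ) b a‖ ^ 2 / 2 =
        ∑ q, d q ^ 2 * frobSq ((V : Op1) * pauli q * (V : Op1)ᴴ) / 2 := by
      simp only [frobSq, Fin.sum_univ_two, Fin.sum_univ_four]
      ring
    rw [h5]
    simp only [h4, EuclideanSpace.real_norm_sq_eq]
    simp [d, Fin.sum_univ_succ]
  rw [noiseConst, ht]
  simp
  linarith

end channel

/-! ### Compositions of linear maps along lists -/

section fold
variable {α M : Type} [AddCommMonoid M] [Module ℂ M]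

/-- The composition of the maps `T x`, `x ∈ l`, the first one being applied first. -/
def foldMap : List α → (α → M →ₗ[ℂ] M) → M →ₗ[ℂ] M
  | [], _ => LinearMap.id
  | x :: l, T => foldMap l T ∘ₗ T x

lemma foldMap_apply (l : List α) (T : α → M →ₗ[ℂ] M) (σ : M) :
    foldMap l T σ = l.foldl (fun σ x => T x σ) σ := by
  induction l generalizing σ with
  | nil => rfl
  | cons x l ih => exact ih _

lemma foldMap_append (l l' : List α) (T : α → M →ₗ[ℂ] M) :
    foldMap (l ++ l') T = foldMap l' T ∘ₗ foldMap l T := by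
  induction l with
  | nil => rfl
  | cons x l ih => rw [List.cons_append, foldMap, ih, foldMap, LinearMap.comp_assoc]

lemma foldMap_map {β : Type} (f : β → α) (l : List β) (T : α → M →ₗ[ℂ] M) :
    foldMap (l.map f) T = foldMap l (T ∘ f) := by
  induction l with
  | nil => rfl
  | cons x l ih => rw [List.map_cons, foldMap, ih, foldMap]; rfl

lemma foldMap_congr {l : List α} {T T' : α → M →ₗ[ℂ] M} (h : ∀ x ∈ l, T x = T' x) :
    foldMap l T = foldMap l T' := by
  induction l with
  | nil => rfl
  | cons x l ih =>
    rw [foldMap, foldMap, h x (by simp), ih fun y hy => h y (by simp [hy])]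

/-- A circuit is linear in the map of each single gate. This gives both the sesquilinear dependence
on a random gate and the derivative in a parameter. -/
lemma foldMap_update [DecidableEq α] {l : List α} (hl : l.Nodup) {x : α} (hx : x ∈ l)
    (T : α → M →ₗ[ℂ] M) :
    ∃ R S : M →ₗ[ℂ] M, ∀ A, foldMap l (Function.update T x A) = R ∘ₗ A ∘ₗ S := by
  obtain ⟨l₁, l₂, rfl⟩ := List.append_of_mem hx
  refine ⟨foldMap l₂ T, foldMap l₁ T, fun A => ?_⟩
  rw [List.nodup_append] at hl
  have h1 : ∀ y ∈ l₁, Function.update T x A y = T y := fun y hy =>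
    Function.update_of_ne (hl.2.2 y hy x (by simp)) _ _
  have h2 : ∀ y ∈ l₂, Function.update T x A y = T y := fun y hy => by
    refine Function.update_of_ne ?_ _ _
    rintro rfl
    exact (List.nodup_cons.mp hl.2.1).1 hy
  rw [foldMap_append, foldMap, foldMap_congr h1, foldMap_congr h2, Function.update_self]
  rfl

/-- A telescoping change of frame: `X i` is the map still to be absorbed before step `i`, and the
intertwining relations carry it from one end of the composition to the other. -/
lemma foldMap_finRange_intertwine (n : ℕ) (B B' : Fin n → M →ₗ[ℂ] M) (X : ℕ → M →ₗ[ℂ] M)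
    (h : ∀ i : Fin n, X (i + 1) ∘ₗ B' i = B i ∘ₗ X i) :
    X n ∘ₗ foldMap (List.finRange n) B' = foldMap (List.finRange n) B ∘ₗ X 0 := by
  induction n generalizing X with
  | zero => rfl
  | succ n ih =>
    rw [List.finRange_succ, foldMap, foldMap, foldMap_map, foldMap_map]
    have h1 := ih (B ∘ Fin.succ) (B' ∘ Fin.succ) (fun i => X (i + 1)) fun i => by
      simpa using h i.succ
    have h2 := h 0
    simp only [Fin.val_zero, zero_add] at h1 h2
    rw [← LinearMap.comp_assoc, h1, LinearMap.comp_assoc, h2, LinearMap.comp_assoc]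

/-- A layered circuit with gates `K`, noise `E` and final maps `S` in each layer. -/
def circuitMap {L : ℕ} (len : Fin L → ℕ) (E : M →ₗ[ℂ] M) (K : (Σ ℓ, Fin (len ℓ)) → M →ₗ[ℂ] M)
    (S : Fin L → M →ₗ[ℂ] M) : M →ₗ[ℂ] M :=
  foldMap (List.finRange L) fun ℓ =>
    S ℓ ∘ₗ E ∘ₗ foldMap (List.finRange (len ℓ)) fun s => K ⟨ℓ, s⟩

lemma circuitMap_update_gate {L : ℕ} (len : Fin L → ℕ) (E : M →ₗ[ℂ] M)
    (K : (Σ ℓ, Fin (len ℓ)) → M →ₗ[ℂ] M) (S : Fin L → M →ₗ[ℂ] M) (g : Σ ℓ, Fin (len ℓ)) :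
    ∃ R T : M →ₗ[ℂ] M, ∀ A, circuitMap len E (Function.update K g A) S = R ∘ₗ A ∘ₗ T := by
  obtain ⟨ℓ, s⟩ := g
  obtain ⟨R₁, T₁, h₁⟩ := foldMap_update (List.nodup_finRange (len ℓ)) (List.mem_finRange s)
    fun s => K ⟨ℓ, s⟩
  obtain ⟨R₂, T₂, h₂⟩ := foldMap_update (List.nodup_finRange L) (List.mem_finRange ℓ)
    fun ℓ => S ℓ ∘ₗ E ∘ₗ foldMap (List.finRange (len ℓ)) fun s => K ⟨ℓ, s⟩
  refine ⟨R₂ ∘ₗ S ℓ ∘ₗ E ∘ₗ R₁, T₁ ∘ₗ T₂, fun A => ?_⟩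
  have h3 : (fun ℓ' => S ℓ' ∘ₗ E ∘ₗ foldMap (List.finRange (len ℓ')) fun s' =>
      Function.update K ⟨ℓ, s⟩ A ⟨ℓ', s'⟩) =
      Function.update (fun ℓ => S ℓ ∘ₗ E ∘ₗ foldMap (List.finRange (len ℓ)) fun s => K ⟨ℓ, s⟩) ℓ
        (S ℓ ∘ₗ E ∘ₗ R₁ ∘ₗ A ∘ₗ T₁) := by
    funext ℓ'
    by_cases h : ℓ' = ℓ
    · subst h
      rw [Function.update_self, ← h₁]
      congr 3
      funext s'
      by_cases hs : s' = s
      · subst hs; simp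
      · rw [Function.update_of_ne hs, Function.update_of_ne]
        simpa using hs
    · rw [Function.update_of_ne h]
      congr 3
      funext s'
      rw [Function.update_of_ne]
      intro h'
      exact h (congrArg Sigma.fst h')
  rw [circuitMap, h3, h₂]
  simp only [LinearMap.comp_assoc]

lemma circuitMap_update_final {L : ℕ} (len : Fin L → ℕ) (E : M →ₗ[ℂ] M)
    (K : (Σ ℓ, Fin (len ℓ)) → M →ₗ[ℂ] M) (S : Fin L → M →ₗ[ℂ] M) (ℓ : Fin L) :
    ∃ R T : M →ₗ[ℂ] M, ∀ A, circuitMap len E K (Function.update S ℓ A) = R ∘ₗ A ∘ₗ T := by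
  obtain ⟨R₂, T₂, h₂⟩ := foldMap_update (List.nodup_finRange L) (List.mem_finRange ℓ)
    fun ℓ => S ℓ ∘ₗ E ∘ₗ foldMap (List.finRange (len ℓ)) fun s => K ⟨ℓ, s⟩
  refine ⟨R₂, E ∘ₗ (foldMap (List.finRange (len ℓ)) fun s => K ⟨ℓ, s⟩) ∘ₗ T₂, fun A => ?_⟩
  have h3 : (fun ℓ' => Function.update S ℓ A ℓ' ∘ₗ E ∘ₗ
      foldMap (List.finRange (len ℓ')) fun s' => K ⟨ℓ', s'⟩) =
      Function.update (fun ℓ => S ℓ ∘ₗ E ∘ₗ foldMap (List.finRange (len ℓ)) fun s => K ⟨ℓ, s⟩) ℓ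
        (A ∘ₗ E ∘ₗ foldMap (List.finRange (len ℓ)) fun s => K ⟨ℓ, s⟩) := by
    funext ℓ'
    by_cases h : ℓ' = ℓ
    · subst h
      simp
    · simp [h]
  rw [circuitMap, h3, h₂]
  simp only [LinearMap.comp_assoc]

end fold

/-! ### Bounds in the Heisenberg picture -/

section dual
variable {n : ℕ}

/-- In the Heisenberg picture, `T` maps traceless operators to traceless operators and increases
their operator norm at most by the factor `κ`. -/
def DualBound (κ : ℝ) (T : QOp n →ₗ[ℂ] QOp n) : Prop :=
  ∀ X : QOp n, X.trace = 0 → ∃ Y : QOp n, Y.trace = 0 ∧ ‖Y‖ ≤ κ * ‖X‖ ∧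
    ∀ σ, (X * T σ).trace = (Y * σ).trace

lemma dualBound_id : DualBound 1 (LinearMap.id : QOp n →ₗ[ℂ] QOp n) := fun X hX =>
  ⟨X, hX, by simp, fun σ => rfl⟩

lemma DualBound.comp {κ₁ κ₂ : ℝ} {T₁ T₂ : QOp n →ₗ[ℂ] QOp n} (h₁ : DualBound κ₁ T₁)
    (h₂ : DualBound κ₂ T₂) (hκ : 0 ≤ κ₂) : DualBound (κ₂ * κ₁) (T₁ ∘ₗ T₂) := fun X hX => by
  obtain ⟨Y, hY, hn, ht⟩ := h₁ X hX
  obtain ⟨Z, hZ, hn', ht'⟩ := h₂ Y hY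
  refine ⟨Z, hZ, ?_, fun σ => ?_⟩
  · rw [mul_assoc]
    exact hn'.trans (by gcongr)
  · rw [LinearMap.comp_apply, ht, ht']

lemma trace_mul_conjMap {ι : Type} [Fintype ι] (X U σ : Matrix ι ι ℂ) :
    (X * conjMap U σ).trace = (Uᴴ * X * U * σ).trace := by
  rw [conjMap_apply, ← Matrix.mul_assoc, ← Matrix.mul_assoc, trace_mul_comm]
  simp only [Matrix.mul_assoc]

lemma trace_conj_unitary {ι : Type} [Fintype ι] [DecidableEq ι] {U : Matrix ι ι ℂ}
    (hU : U ∈ unitaryGroup ι ℂ) (X : Matrix ι ι ℂ) : (Uᴴ * X * U).trace = X.trace := by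
  rw [trace_mul_comm, ← Matrix.mul_assoc, ← star_eq_conjTranspose, mem_unitaryGroup_iff.mp hU,
    Matrix.one_mul]

lemma dualBound_conjMap {U : QOp n} (hU : U ∈ unitaryGroup (Fin n → Fin 2) ℂ) :
    DualBound 1 (conjMap U) := fun X hX =>
  ⟨Uᴴ * X * U, by rw [trace_conj_unitary hU, hX],
    by rw [one_mul]; exact norm_conjMap_unitary_le hU X, fun σ => trace_mul_conjMap X U σ⟩

lemma dualBound_foldMap {α : Type} (l : List α) {κ : α → ℝ} {T : α → QOp n →ₗ[ℂ] QOp n}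
    (hκ : ∀ x, 0 ≤ κ x) (h : ∀ x, DualBound (κ x) (T x)) :
    DualBound (l.map κ).prod (foldMap l T) := by
  induction l with
  | nil => exact dualBound_id
  | cons x l ih =>
    rw [List.map_cons, List.prod_cons]
    exact ih.comp (h x) (hκ x)

/-- In an eigenbasis of `ρ` the trace is a convex combination of diagonal entries of `X`. -/
lemma norm_trace_mul_state_le {ρ : QOp n} (hρ : IsState ρ) (X : QOp n) :
    ‖(X * ρ).trace‖ ≤ ‖X‖ := by
  set hJ := hρ.1.isHermitian
  have h0 : ∀ i, 0 ≤ hJ.eigenvalues i := hρ.1.eigenvalues_nonneg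
  have h2 : ∑ i, hJ.eigenvalues i = 1 := by
    have h := hρ.2
    rw [hJ.trace_eq_sum_eigenvalues] at h
    simpa using congrArg Complex.re h
  have h := hJ.spectral_theorem
  rw [Unitary.conjStarAlgAut_apply] at h
  set W : QOp n := (hJ.eigenvectorUnitary : QOp n)
  have hW : W ∈ unitaryGroup (Fin n → Fin 2) ℂ := hJ.eigenvectorUnitary.2
  have h3 : (X * ρ).trace = ∑ i, (Wᴴ * X * W) i i * hJ.eigenvalues i := by
    conv_lhs => rw [h]
    rw [← Matrix.mul_assoc, ← Matrix.mul_assoc, trace_mul_comm, ← Matrix.mul_assoc,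
      ← Matrix.mul_assoc]
    simp only [trace, diag_apply, mul_diagonal]
    rfl
  rw [h3]
  calc ‖∑ i, (Wᴴ * X * W) i i * hJ.eigenvalues i‖
      ≤ ∑ i, ‖(Wᴴ * X * W) i i * hJ.eigenvalues i‖ := norm_sum_le _ _
    _ ≤ ∑ i, ‖X‖ * hJ.eigenvalues i := by
        refine Finset.sum_le_sum fun i _ => ?_
        rw [norm_mul, Complex.norm_real, Real.norm_of_nonneg (h0 i)]
        exact mul_le_mul_of_nonneg_right
          ((norm_entry_le _ i i).trans (norm_conjMap_unitary_le hW X)) (h0 i)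
    _ = ‖X‖ := by rw [← Finset.mul_sum, h2, mul_one]

/-- The tensor power of a channel as a linear map. -/
def tensorPowerMap (N : Op1 →ₗ[ℂ] Op1) (n : ℕ) : QOp n →ₗ[ℂ] QOp n where
  toFun := tensorPower N n
  map_add' ρ σ := by simp [tensorPower, add_smul, Finset.sum_add_distrib]
  map_smul' c ρ := by simp [tensorPower, mul_smul, Finset.smul_sum]

@[simp] lemma tensorPowerMap_apply (N : Op1 →ₗ[ℂ] Op1) (ρ : QOp n) :
    tensorPowerMap N n ρ = tensorPower N n ρ := rfl

lemma trace_pauliString_mul_tensorPower (N : Op1 →ₗ[ℂ] Op1) (p : Fin n → Fin 4) (σ : QOp n) :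
    (pauliString p * tensorPowerMap N n σ).trace =
      ((tensorOp fun k => heisenberg N (p k)) * σ).trace := by
  rw [tensorPowerMap_apply, tensorPower]
  simp only [Finset.mul_sum, trace_sum, Matrix.mul_smul, trace_smul, pauliString, tensorOp_mul,
    trace_tensorOp]
  rw [trace_mul_eq_sum, Finset.sum_comm]
  refine Finset.sum_congr rfl fun a _ => Finset.sum_congr rfl fun b _ => ?_
  simp only [tensorOp, heisenberg, smul_eq_mul]
  ring

/-- Each tensor factor is a multiple of a unitary, hence so is the product, and its norm can be read
off from the scalar. -/
lemma norm_sq_tensorOp_heisenberg_le {N : Op1 →ₗ[ℂ] Op1} (hN : IsChannel N)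
    (hunital : IsUnital N) (p : Fin n → Fin 4) :
    ‖tensorOp fun k => heisenberg N (p k)‖ ^ 2 ≤ ∏ k, lengthSq N (p k) := by
  have h1 := l2_opNorm_conjTranspose_mul_self (tensorOp fun k => heisenberg N (p k))ᴴ
  rw [l2_opNorm_conjTranspose, conjTranspose_conjTranspose, tensorOp_conjTranspose, tensorOp_mul]
    at h1
  simp only [heisenberg_mul_conjTranspose hN hunital] at h1
  rw [tensorOp_smul, tensorOp_one, norm_smul] at h1
  rw [sq, ← h1]
  have h2 : ‖(1 : QOp n)‖ = 1 := norm_of_unitary (one_mem _)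
  rw [h2, mul_one, ← Complex.ofReal_prod, Complex.norm_real, Real.norm_of_nonneg]
  exact Finset.prod_nonneg fun k _ => lengthSq_nonneg N _

lemma pauliWeight_eq_zero_iff (p : Fin n → Fin 4) : pauliWeight p = 0 ↔ p = 0 := by
  simp [pauliWeight, Finset.filter_eq_empty_iff, funext_iff]

/-- One layer of twirled noise. -/
lemma sum_norm_sq_twirled_noise_le {N : Op1 →ₗ[ℂ] Op1} (hN : IsChannel N) (hunital : IsUnital N)
    {Ω : Type} [Fintype Ω] (σ : Ω → QOp n) {β κ : ℝ} (hβ : 0 ≤ β)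
    (hσ : ∀ X : QOp n, X.trace = 0 → ∑ v, ‖(X * σ v).trace‖ ^ 2 ≤ β * ‖X‖ ^ 2)
    {T : QOp n →ₗ[ℂ] QOp n} (hT : DualBound κ T) (X : QOp n) (hX : X.trace = 0) :
    ∑ v, ∑ a : Fin n → TwirlIndex,
        ‖(X * conjMap (twirlOp a) (tensorPowerMap N n (T (σ v)))).trace‖ ^ 2 ≤
      12 ^ n * (κ ^ 2 * β * ∑ p, ‖pauliCoeff X p‖ ^ 2 * contraction N ^ pauliWeight p) := by
  let f : Ω → QOp n →ₗ[ℂ] ℂ := fun v =>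
    traceLinearMap _ ℂ ℂ ∘ₗ LinearMap.mulRight ℂ (tensorPowerMap N n (T (σ v)))
  have hf : ∀ v A, f v A = (A * tensorPowerMap N n (T (σ v))).trace := fun v A => rfl
  have h1 : ∀ v, ∑ a : Fin n → TwirlIndex,
      ‖(X * conjMap (twirlOp a) (tensorPowerMap N n (T (σ v)))).trace‖ ^ 2 =
      4 ^ n * ∑ j : Fin n → Fin 3, ∑ p,
        ‖pauliCoeff X p‖ ^ 2 * ‖f v (pauliString fun k => axisPerm (j k) (p k))‖ ^ 2 := by
    intro v
    rw [← sum_norm_sq_twirl]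
    simp only [hf, trace_mul_conjMap]
  -- The dual noise keeps a nontrivial string traceless, and so does the dual of `T`; this is what
  -- allows the hypothesis on the ensemble `σ` to be applied.
  have h2 : ∀ p : Fin n → Fin 4, p ≠ 0 →
      ∑ v, ‖f v (pauliString p)‖ ^ 2 ≤ β * κ ^ 2 * ∏ k, lengthSq N (p k) := by
    intro p hp
    obtain ⟨k, hk⟩ := Function.ne_iff.mp hp
    obtain ⟨Y, hY, hn, ht⟩ := hT (tensorOp fun k => heisenberg N (p k)) (by
      rw [trace_tensorOp]
      exact Finset.prod_eq_zero (Finset.mem_univ k) (trace_heisenberg hunital hk))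
    simp only [hf, trace_pauliString_mul_tensorPower, ht]
    refine (hσ Y hY).trans ?_
    rw [mul_assoc]
    refine mul_le_mul_of_nonneg_left ?_ hβ
    calc ‖Y‖ ^ 2 ≤ (κ * ‖tensorOp fun k => heisenberg N (p k)‖) ^ 2 := by gcongr
      _ = κ ^ 2 * ‖tensorOp fun k => heisenberg N (p k)‖ ^ 2 := by ring
      _ ≤ _ := mul_le_mul_of_nonneg_left (norm_sq_tensorOp_heisenberg_le hN hunital p)
        (sq_nonneg _)
  have h3 : ∀ p : Fin n → Fin 4, ∑ j : Fin n → Fin 3, ‖pauliCoeff X p‖ ^ 2 *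
      ∑ v, ‖f v (pauliString fun k => axisPerm (j k) (p k))‖ ^ 2 ≤
      3 ^ n * (κ ^ 2 * β * (‖pauliCoeff X p‖ ^ 2 * contraction N ^ pauliWeight p)) := by
    intro p
    by_cases hp : p = 0
    · subst hp
      simp [pauliCoeff_zero X hX]
    · calc _ ≤ ∑ j : Fin n → Fin 3, ‖pauliCoeff X p‖ ^ 2 *
            (β * κ ^ 2 * ∏ k, lengthSq N (axisPerm (j k) (p k))) := by
            refine Finset.sum_le_sum fun j _ => mul_le_mul_of_nonneg_left (h2 _ ?_) (sq_nonneg _)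
            obtain ⟨k, hk⟩ := Function.ne_iff.mp hp
            exact Function.ne_iff.mpr ⟨k, fun h => hk ((axisPerm_eq_zero_iff _ _).mp h)⟩
        _ = _ := by
            rw [← Finset.mul_sum, ← Finset.mul_sum, sum_prod_axisPerm _ (lengthSq_zero hN)]
            rw [contraction]
            ring
  simp only [h1]
  rw [← Finset.mul_sum]
  have h4 : ∑ v, ∑ j : Fin n → Fin 3, ∑ p,
        ‖pauliCoeff X p‖ ^ 2 * ‖f v (pauliString fun k => axisPerm (j k) (p k))‖ ^ 2 =
      ∑ p, ∑ j : Fin n → Fin 3, ‖pauliCoeff X p‖ ^ 2 *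
        ∑ v, ‖f v (pauliString fun k => axisPerm (j k) (p k))‖ ^ 2 := by
    simp only [Finset.mul_sum]
    rw [Finset.sum_comm, Finset.sum_comm (s := Finset.univ (α := Fin n → Fin 4))]
    refine Finset.sum_congr rfl fun j _ => ?_
    rw [Finset.sum_comm]
  rw [h4]
  calc _ ≤ 4 ^ n * ∑ p, 3 ^ n * (κ ^ 2 * β *
          (‖pauliCoeff X p‖ ^ 2 * contraction N ^ pauliWeight p)) := by
          gcongr with p
          exact h3 p
    _ = _ := by
      -- The factor `12 ^ n = 4 ^ n * 3 ^ n` is the number of twirl labels, so after normalization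
      -- it disappears.
      rw [← Finset.mul_sum, ← Finset.mul_sum, ← mul_assoc, ← mul_pow]
      norm_num

end dual

/-! ### Circuits with twirled noise -/

section twirled
variable {n L : ℕ}

lemma sum_sum_update {I A : Type} [Fintype I] [DecidableEq I] [Fintype A] (i : I)
    (h : (I → A) → ℝ) :
    ∑ w : I → A, ∑ a, h (Function.update w i a) = Fintype.card A * ∑ w, h w := by
  -- Resampling one coordinate preserves the uniform distribution: exchanging the old and the new
  -- value is an involution.
  let e : (I → A) × A ≃ (I → A) × A :=
    { toFun := fun x => (Function.update x.1 i x.2, x.1 i)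
      invFun := fun x => (Function.update x.1 i x.2, x.1 i)
      left_inv := fun x => by simp
      right_inv := fun x => by simp }
  calc ∑ w : I → A, ∑ a, h (Function.update w i a) = ∑ x : (I → A) × A, h (e x).1 := by
        rw [Fintype.sum_prod_type]
        rfl
    _ = ∑ x : (I → A) × A, h x.1 := e.sum_comp fun x => h x.1
    _ = _ := by
      rw [Fintype.sum_prod_type]
      simp [Finset.mul_sum]

/-- The circuit with layers `𝒮 ℓ ∘ 𝒲 ℓ ∘ N^{⊗n} ∘ 𝒯 ℓ` for the twirl unitaries `w`. -/
def twirledCircuit (N : Op1 →ₗ[ℂ] Op1) (T S : Fin L → QOp n →ₗ[ℂ] QOp n) (l : List (Fin L))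
    (w : Fin L → Fin n → TwirlIndex) : QOp n →ₗ[ℂ] QOp n :=
  foldMap l fun ℓ => S ℓ ∘ₗ conjMap (twirlOp (w ℓ)) ∘ₗ tensorPowerMap N n ∘ₗ T ℓ

variable {N : Op1 →ₗ[ℂ] Op1} {T S : Fin L → QOp n →ₗ[ℂ] QOp n}

/-- Since `ℓ ∉ l`, the twirl of layer `ℓ` is independent of the state that enters the layer, so it
can be averaged on its own. -/
lemma sum_twirledCircuit_step_le (hN : IsChannel N) (hunital : IsUnital N)
    (l : List (Fin L)) (ℓ : Fin L) (hℓ : ℓ ∉ l) (ρ : QOp n) {β κ : ℝ} (hβ : 0 ≤ β)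
    (hσ : ∀ X : QOp n, X.trace = 0 →
      ∑ w, ‖(X * twirledCircuit N T S l w ρ).trace‖ ^ 2 ≤ β * ‖X‖ ^ 2)
    (hT : DualBound κ (T ℓ)) (X : QOp n) (hX : X.trace = 0) :
    ∑ w, ‖(X * conjMap (twirlOp (w ℓ))
        (tensorPowerMap N n (T ℓ (twirledCircuit N T S l w ρ)))).trace‖ ^ 2 ≤
      κ ^ 2 * β * ∑ p, ‖pauliCoeff X p‖ ^ 2 * contraction N ^ pauliWeight p := by
  have h := sum_norm_sq_twirled_noise_le hN hunital (fun w => twirledCircuit N T S l w ρ) hβ hσ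
    hT X hX
  have h1 : ∀ (w : Fin L → Fin n → TwirlIndex) a,
      twirledCircuit N T S l (Function.update w ℓ a) = twirledCircuit N T S l w := fun w a =>
    foldMap_congr fun x hx => by
      rw [Function.update_of_ne]
      rintro rfl
      exact hℓ hx
  have h2 := sum_sum_update ℓ fun w : Fin L → Fin n → TwirlIndex =>
    ‖(X * conjMap (twirlOp (w ℓ))
        (tensorPowerMap N n (T ℓ (twirledCircuit N T S l w ρ)))).trace‖ ^ 2
  simp only [h1, Function.update_self] at h2
  rw [h2] at h
  have h3 : (Fintype.card (Fin n → TwirlIndex) : ℝ) = 12 ^ n := by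
    simp
  rw [h3] at h
  exact le_of_mul_le_mul_left h (by positivity)

/-- Layers are removed from the output end. A traceless observable has no component at weight zero,
so with `contraction N ≤ 1` every layer gains at least one factor. -/
lemma sum_twirledCircuit_le (hN : IsChannel N) (hunital : IsUnital N) {ρ : QOp n}
    (hρ : IsState ρ) {κ : Fin L → ℝ} (hT : ∀ ℓ, DualBound (κ ℓ) (T ℓ))
    (hS : ∀ ℓ, DualBound 1 (S ℓ)) (l : List (Fin L)) (hl : l.Nodup) (X : QOp n)
    (hX : X.trace = 0) :
    ∑ w, ‖(X * twirledCircuit N T S l w ρ).trace‖ ^ 2 ≤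
      Fintype.card (Fin L → Fin n → TwirlIndex) * (l.map fun ℓ => κ ℓ ^ 2).prod *
        contraction N ^ l.length * ‖X‖ ^ 2 := by
  induction l using List.reverseRecOn generalizing X with
  | nil =>
    simp only [twirledCircuit, foldMap, LinearMap.id_apply, Finset.sum_const, Finset.card_univ,
      nsmul_eq_mul, List.map_nil, List.prod_nil, List.length_nil, pow_zero, mul_one]
    gcongr
    exact norm_trace_mul_state_le hρ X
  | append_singleton l ℓ ih =>
    have hl' := List.nodup_append.mp hl
    have hℓ : ℓ ∉ l := fun h => hl'.2.2 ℓ h ℓ (by simp) rfl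
    have hc := contraction_nonneg N
    have hβ : 0 ≤ Fintype.card (Fin L → Fin n → TwirlIndex) * (l.map fun ℓ => κ ℓ ^ 2).prod *
        contraction N ^ l.length := by
      refine mul_nonneg (mul_nonneg (by positivity) (List.prod_nonneg ?_)) (by positivity)
      intro a ha
      obtain ⟨x, _, rfl⟩ := List.mem_map.mp ha
      positivity
    obtain ⟨Y, hY, hn, ht⟩ := hS ℓ X hX
    have h1 := sum_twirledCircuit_step_le hN hunital l ℓ hℓ ρ hβ (ih hl'.1) (hT ℓ) Y hY
    have h2 : ∑ p, ‖pauliCoeff Y p‖ ^ 2 * contraction N ^ pauliWeight p ≤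
        contraction N * ‖X‖ ^ 2 := by
      calc _ ≤ ∑ p, contraction N * ‖pauliCoeff Y p‖ ^ 2 := by
            refine Finset.sum_le_sum fun p _ => ?_
            by_cases hp : p = 0
            · subst hp; simp [pauliCoeff_zero Y hY]
            · rw [mul_comm]
              refine mul_le_mul_of_nonneg_right ?_ (sq_nonneg _)
              exact pow_le_of_le_one hc (contraction_le_one hN)
                (fun h => hp ((pauliWeight_eq_zero_iff p).mp h))
        _ ≤ contraction N * ‖X‖ ^ 2 := by
            rw [← Finset.mul_sum]
            refine mul_le_mul_of_nonneg_left ?_ hc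
            refine (sum_norm_sq_pauliCoeff_le Y).trans ?_
            rw [one_mul] at hn
            gcongr
    simp only [twirledCircuit, foldMap_append, foldMap, LinearMap.comp_apply, LinearMap.id_apply,
      ht] at h1 ⊢
    refine h1.trans ?_
    rw [List.map_append, List.prod_append, List.length_append]
    calc _ ≤ κ ℓ ^ 2 * (Fintype.card (Fin L → Fin n → TwirlIndex) *
          (l.map fun ℓ => κ ℓ ^ 2).prod * contraction N ^ l.length) *
          (contraction N * ‖X‖ ^ 2) := by
          exact mul_le_mul_of_nonneg_left h2 (mul_nonneg (sq_nonneg _) hβ)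
      _ = _ := by
          simp [pow_succ]; ring

/-- The second moment of a Pauli string in a circuit that ends with the layer `ℓ`. -/
lemma sum_twirledCircuit_pauliString_le (hN : IsChannel N) (hunital : IsUnital N) {ρ : QOp n}
    (hρ : IsState ρ) {κ : Fin L → ℝ} (hT : ∀ ℓ, DualBound (κ ℓ) (T ℓ))
    (hS : ∀ ℓ, DualBound 1 (S ℓ)) (l : List (Fin L)) (ℓ : Fin L) (hl : (l ++ [ℓ]).Nodup)
    {p : Fin n → Fin 4} (Y : QOp n) (hY : Y.trace = 0) (hn : ‖Y‖ ≤ 1)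
    (ht : ∀ σ, (pauliString p * S ℓ σ).trace = (Y * σ).trace)
    (hw : ∀ q, pauliCoeff Y q ≠ 0 → pauliWeight q = pauliWeight p) :
    ∑ w, ‖(pauliString p * twirledCircuit N T S (l ++ [ℓ]) w ρ).trace‖ ^ 2 ≤
      Fintype.card (Fin L → Fin n → TwirlIndex) * ((l ++ [ℓ]).map fun ℓ => κ ℓ ^ 2).prod *
        contraction N ^ (pauliWeight p + l.length) := by
  have hl' := List.nodup_append.mp hl
  have hℓ : ℓ ∉ l := fun h => hl'.2.2 ℓ h ℓ (by simp) rfl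
  have hc := contraction_nonneg N
  have hβ : 0 ≤ Fintype.card (Fin L → Fin n → TwirlIndex) * (l.map fun ℓ => κ ℓ ^ 2).prod *
      contraction N ^ l.length := by
    refine mul_nonneg (mul_nonneg (by positivity) (List.prod_nonneg ?_)) (by positivity)
    intro a ha
    obtain ⟨x, _, rfl⟩ := List.mem_map.mp ha
    positivity
  have h1 := sum_twirledCircuit_step_le hN hunital l ℓ hℓ ρ hβ
    (sum_twirledCircuit_le hN hunital hρ hT hS l hl'.1) (hT ℓ) Y hY
  -- All strings occurring in `Y` have the weight of `p`, so this layer gains the full power and not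
  -- just one factor.
  have h2 : ∑ q, ‖pauliCoeff Y q‖ ^ 2 * contraction N ^ pauliWeight q ≤
      contraction N ^ pauliWeight p := by
    calc _ = ∑ q, contraction N ^ pauliWeight p * ‖pauliCoeff Y q‖ ^ 2 := by
          refine Finset.sum_congr rfl fun q _ => ?_
          by_cases hq : pauliCoeff Y q = 0
          · simp [hq]
          · rw [hw q hq, mul_comm]
      _ ≤ contraction N ^ pauliWeight p * 1 := by
          rw [← Finset.mul_sum]
          refine mul_le_mul_of_nonneg_left ?_ (by positivity)
          exact (sum_norm_sq_pauliCoeff_le Y).trans (pow_le_one₀ (norm_nonneg _) hn)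
      _ = _ := mul_one _
  simp only [twirledCircuit, foldMap_append, foldMap, LinearMap.comp_apply, LinearMap.id_apply,
    ht] at h1 ⊢
  refine h1.trans ?_
  rw [List.map_append, List.prod_append]
  calc _ ≤ κ ℓ ^ 2 * (Fintype.card (Fin L → Fin n → TwirlIndex) *
        (l.map fun ℓ => κ ℓ ^ 2).prod * contraction N ^ l.length) *
        contraction N ^ pauliWeight p :=
        mul_le_mul_of_nonneg_left h2 (mul_nonneg (sq_nonneg _) hβ)
    _ = _ := by
        simp [pow_add]; ring

end twirled

/-! ### Random circuits as compositions of linear maps -/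

section circuit
variable {n L : ℕ} (C : RandomCircuit n L)

/-- The unitary channel of the gate at position `g`. -/
def gateMap (θ : C.Pos → ℝ) (ω : C.Sample) (g : C.Pos) : QOp n →ₗ[ℂ] QOp n :=
  conjMap (onQubits (C.fst g) (C.snd g) (C.gate θ ω g))

/-- The unitary channel of the single-qubit gates that end layer `ℓ`. -/
def finalMap (ω : C.Sample) (ℓ : Fin L) : QOp n →ₗ[ℂ] QOp n :=
  if C.hasSingle ℓ = true then conjMap (tensorOp fun q => (ω.2 (ℓ, q) : Op1)) else LinearMap.id

/-- The gates of layer `ℓ`, with the maps `D g` inserted after the gates. -/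
def gatesMap (θ : C.Pos → ℝ) (D : C.Pos → QOp n →ₗ[ℂ] QOp n) (ω : C.Sample) (ℓ : Fin L) :
    QOp n →ₗ[ℂ] QOp n :=
  foldMap (List.finRange (C.len ℓ)) fun s => D ⟨ℓ, s⟩ ∘ₗ gateMap C θ ω ⟨ℓ, s⟩

/-- The noisy circuit, with the maps `D g` inserted after the gates. -/
def probeMap (N : Op1 →ₗ[ℂ] Op1) (θ : C.Pos → ℝ) (D : C.Pos → QOp n →ₗ[ℂ] QOp n)
    (ω : C.Sample) : QOp n →ₗ[ℂ] QOp n :=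
  circuitMap C.len (tensorPowerMap N n) (fun g => D g ∘ₗ gateMap C θ ω g) (finalMap C ω)

/-- The trace of a Pauli string against the output of the circuit with insertions. -/
def amplitude (N : Op1 →ₗ[ℂ] Op1) (ρ₀ : QOp n) (p : Fin n → Fin 4) (θ : C.Pos → ℝ)
    (D : C.Pos → QOp n →ₗ[ℂ] QOp n) (ω : C.Sample) : ℂ :=
  (pauliString p * probeMap C N θ D ω ρ₀).trace

lemma channel_eq_probeMap (N : Op1 →ₗ[ℂ] Op1) (θ : C.Pos → ℝ) (ω : C.Sample) (ρ : QOp n) :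
    C.channel N θ ω ρ = probeMap C N θ (fun _ => LinearMap.id) ω ρ := by
  rw [RandomCircuit.channel, probeMap, circuitMap, foldMap_apply]
  congr 1
  funext σ ℓ
  simp only [LinearMap.comp_apply, foldMap_apply, tensorPowerMap_apply]
  rw [RandomCircuit.singleLayer, finalMap]
  split_ifs <;> rfl

lemma cost_eq_re_amplitude (N : Op1 →ₗ[ℂ] Op1) (ρ₀ : QOp n) (p : Fin n → Fin 4)
    (θ : C.Pos → ℝ) (ω : C.Sample) :
    C.cost N ρ₀ p θ ω = (amplitude C N ρ₀ p θ (fun _ => LinearMap.id) ω).re := by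
  rw [RandomCircuit.cost, channel_eq_probeMap, amplitude]

lemma gate_mem_unitary (θ : C.Pos → ℝ) (ω : C.Sample) (g : C.Pos) :
    C.gate θ ω g ∈ unitaryGroup (Fin 2 × Fin 2) ℂ := by
  rw [RandomCircuit.gate]
  split
  · exact (ω.1 g).2
  · rename_i H hH
    let +nondep : NormedAlgebra ℚ Op2 := .restrictScalars ℚ ℂ Op2
    refine NormedSpace.exp_mem_unitary_of_mem_skewAdjoint ?_
    rw [skewAdjoint.mem_iff, star_smul, (C.isHermitian g H hH).star_eq]
    simp

lemma gate_of_random (θ : C.Pos → ℝ) (ω : C.Sample) {g : C.Pos} (hg : C.generator g = none) :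
    C.gate θ ω g = (ω.1 g : Op2) := by
  rw [RandomCircuit.gate, hg]

lemma gate_of_generator (θ : C.Pos → ℝ) (ω : C.Sample) {g : C.Pos} {H : Op2}
    (hg : C.generator g = some H) :
    C.gate θ ω g = NormedSpace.exp ((-(Complex.I * (θ g : ℂ))) • H) := by
  rw [RandomCircuit.gate, hg]

lemma gate_congr (θ : C.Pos → ℝ) {ω ω' : C.Sample} {g : C.Pos} (h : ω.1 g = ω'.1 g) :
    C.gate θ ω g = C.gate θ ω' g := by
  rw [RandomCircuit.gate, RandomCircuit.gate, h]

lemma dualBound_gateMap (θ : C.Pos → ℝ) (ω : C.Sample) (g : C.Pos) :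
    DualBound 1 (gateMap C θ ω g) :=
  dualBound_conjMap (onQubits_mem_unitary (C.fst_ne_snd g) (gate_mem_unitary C θ ω g))

lemma dualBound_finalMap (ω : C.Sample) (ℓ : Fin L) : DualBound 1 (finalMap C ω ℓ) := by
  rw [finalMap]
  split_ifs
  · exact dualBound_conjMap (tensorOp_mem_unitary fun q => (ω.2 (ℓ, q)).2)
  · exact dualBound_id

/-! ### Inserting single-qubit unitaries after the noise -/

/-- The tensor product of two single-qubit unitaries. -/
def kronU (a b : UGroup (Fin 2)) : UGroup (Fin 2 × Fin 2) :=
  ⟨(a : Op1) ⊗ₖ (b : Op1), kronecker_mem_unitary a.2 b.2⟩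

lemma kronU_one : kronU 1 1 = 1 := by
  ext1
  simp [kronU]

/-- The unitaries inserted after the noise of layer `k - 1` which are not absorbed by
single-qubit gates at the end of that layer. -/
def carried (w : Fin L → Fin n → UGroup (Fin 2)) : ℕ → Fin n → UGroup (Fin 2)
  | 0 => 1
  | k + 1 => if h : k < L then (if C.hasSingle ⟨k, h⟩ = true then 1 else w ⟨k, h⟩) else 1

/-- No gate of layer `ℓ` before the `k`-th one acts on the qubit `q`. -/
def Untouched (ℓ : Fin L) (k : ℕ) (q : Fin n) : Prop :=
  ∀ s : Fin (C.len ℓ), (s : ℕ) < k → C.fst ⟨ℓ, s⟩ ≠ q ∧ C.snd ⟨ℓ, s⟩ ≠ q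

open scoped Classical in
/-- The part of the carried unitaries that has not yet been absorbed by the first `k` gates of
layer `ℓ`. -/
def pending (w : Fin L → Fin n → UGroup (Fin 2)) (ℓ : Fin L) (k : ℕ) (q : Fin n) :
    UGroup (Fin 2) :=
  if Untouched C ℓ k q then carried C w ℓ q else 1

/-- The modification of the two-qubit gates that inserts the unitaries `w`. -/
def gateShift (w : Fin L → Fin n → UGroup (Fin 2)) (g : C.Pos) : UGroup (Fin 2 × Fin 2) :=
  kronU (pending C w g.1 g.2 (C.fst g)) (pending C w g.1 g.2 (C.snd g))

/-- The modification of the single-qubit gates that inserts the unitaries `w`. -/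
def singleShift (w : Fin L → Fin n → UGroup (Fin 2)) (k : Fin L × Fin n) : UGroup (Fin 2) :=
  if C.hasSingle k.1 = true then w k.1 k.2 else 1

variable (w : Fin L → Fin n → UGroup (Fin 2))

/-- A parametrized gate never has to absorb anything. A unitary can only be pending if the preceding
single-qubit layer is absent, and then the first gate on its qubit is random by `random_first`. -/
lemma pending_eq_one_of_generator {g : C.Pos} {H : Op2} (hg : C.generator g = some H)
    {q : Fin n} (hq : C.fst g = q ∨ C.snd g = q) : pending C w g.1 g.2 q = 1 := by
  rw [pending]
  split_ifs with hu
  · obtain ⟨⟨k, hk⟩, s⟩ := g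
    cases k with
    | zero => rfl
    | succ k =>
      simp only [carried]
      rw [dif_pos (by omega)]
      split_ifs with hs
      · rfl
      · have h := C.random_first ⟨k, by omega⟩ ⟨k + 1, hk⟩ rfl (by simpa using hs) q s hq
          fun s' hs' => hu s' hs'
        rw [h] at hg
        cases hg
  · rfl

lemma gateShift_of_generator {g : C.Pos} {H : Op2} (hg : C.generator g = some H) :
    gateShift C w g = 1 := by
  rw [gateShift, pending_eq_one_of_generator C w hg (Or.inl rfl),
    pending_eq_one_of_generator C w hg (Or.inr rfl), kronU_one]

/-- The sample with the unitaries `w` inserted. -/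
def shiftSample (ω : C.Sample) : C.Sample := (ω.1 * gateShift C w, ω.2 * singleShift C w)

lemma gateMap_shiftSample (θ : C.Pos → ℝ) (ω : C.Sample) (g : C.Pos) :
    gateMap C θ (shiftSample C w ω) g = gateMap C θ ω g ∘ₗ
      conjMap (onQubits (C.fst g) (C.snd g) (gateShift C w g : Op2)) := by
  rw [gateMap, gateMap, ← conjMap_mul, ← onQubits_mul (C.fst_ne_snd g)]
  cases hg : C.generator g with
  | none =>
    rw [gate_of_random C θ _ hg, gate_of_random C θ _ hg]
    rfl
  | some H =>
    rw [gateShift_of_generator C w hg, gate_of_generator C θ _ hg, gate_of_generator C θ _ hg]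
    simp

/-- The inserted map `D` acts only on the qubits `i` and `j`. -/
def IsLocal (i j : Fin n) (D : QOp n →ₗ[ℂ] QOp n) : Prop :=
  ∀ v : Fin n → Op1, v i = 1 → v j = 1 →
    conjMap (tensorOp v) ∘ₗ D = D ∘ₗ conjMap (tensorOp v)

lemma isLocal_conjMap {i j : Fin n} (hij : i ≠ j) (A : Op2) :
    IsLocal i j (conjMap (onQubits i j A)) := fun v hi hj => by
  rw [← conjMap_mul, ← conjMap_mul, (onQubits_tensorOp_commute hij A v hi hj).eq]

lemma IsLocal.comp {i j : Fin n} {D D' : QOp n →ₗ[ℂ] QOp n} (h : IsLocal i j D)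
    (h' : IsLocal i j D') : IsLocal i j (D ∘ₗ D') := fun v hi hj => by
  rw [← LinearMap.comp_assoc, h v hi hj, LinearMap.comp_assoc, h' v hi hj, LinearMap.comp_assoc]

variable {C} in
-- The unitaries pending after a gate are trivial on its two qubits, so they commute with the gate
-- and with the local insertion. The shift of the gate supplies the factors that it absorbs.
lemma gatesMap_shiftSample (θ : C.Pos → ℝ) {D : C.Pos → QOp n →ₗ[ℂ] QOp n}
    (hD : ∀ g, IsLocal (C.fst g) (C.snd g) (D g)) (ω : C.Sample) (ℓ : Fin L) :
    gatesMap C θ D (shiftSample C w ω) ℓ = gatesMap C θ D ω ℓ ∘ₗ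
      conjMap (tensorOp fun q => (carried C w ℓ q : Op1)) := by
  have h := foldMap_finRange_intertwine (C.len ℓ)
    (fun s => D ⟨ℓ, s⟩ ∘ₗ gateMap C θ ω ⟨ℓ, s⟩)
    (fun s => D ⟨ℓ, s⟩ ∘ₗ gateMap C θ (shiftSample C w ω) ⟨ℓ, s⟩)
    (fun k => conjMap (tensorOp fun q => (pending C w ℓ k q : Op1))) fun s => by
      have hu : ∀ q, Untouched C ℓ (s + 1) q ↔
          Untouched C ℓ s q ∧ C.fst ⟨ℓ, s⟩ ≠ q ∧ C.snd ⟨ℓ, s⟩ ≠ q := by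
        intro q
        refine ⟨fun h => ⟨fun s' hs' => h s' (by omega), h s (by omega)⟩, fun h s' hs' => ?_⟩
        rcases Nat.lt_succ_iff_lt_or_eq.mp hs' with h1 | h1
        · exact h.1 s' h1
        · rw [Fin.ext h1]; exact h.2
      have hi : pending C w ℓ (s + 1) (C.fst ⟨ℓ, s⟩) = 1 :=
        if_neg fun h => ((hu _).mp h).2.1 rfl
      have hj : pending C w ℓ (s + 1) (C.snd ⟨ℓ, s⟩) = 1 :=
        if_neg fun h => ((hu _).mp h).2.2 rfl
      have hk : ∀ q, q ≠ C.fst ⟨ℓ, s⟩ → q ≠ C.snd ⟨ℓ, s⟩ →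
          pending C w ℓ (s + 1) q = pending C w ℓ s q := by
        intro q h1 h2
        have : Untouched C ℓ (s + 1) q ↔ Untouched C ℓ s q := by
          rw [hu]; exact ⟨fun h => h.1, fun h => ⟨h, h1.symm, h2.symm⟩⟩
        rw [pending, pending]
        by_cases hq : Untouched C ℓ s q
        · rw [if_pos hq, if_pos (this.mpr hq)]
        · rw [if_neg hq, if_neg (this.not.mpr hq)]
      have hij := C.fst_ne_snd ⟨ℓ, s⟩
      have hloc : IsLocal (C.fst ⟨ℓ, s⟩) (C.snd ⟨ℓ, s⟩)
          (D ⟨ℓ, s⟩ ∘ₗ gateMap C θ (shiftSample C w ω) ⟨ℓ, s⟩) :=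
        (hD _).comp (isLocal_conjMap hij _)
      have habs : conjMap (onQubits (C.fst ⟨ℓ, s⟩) (C.snd ⟨ℓ, s⟩) (gateShift C w ⟨ℓ, s⟩ : Op2)) ∘ₗ
          conjMap (tensorOp fun q => (pending C w ℓ (s + 1) q : Op1)) =
          conjMap (tensorOp fun q => (pending C w ℓ s q : Op1)) := by
        rw [← conjMap_mul]
        refine congrArg conjMap ?_
        rw [gateShift, kronU, onQubits_kronecker hij, tensorOp_mul]
        refine congrArg tensorOp (funext fun q => ?_)
        by_cases h2 : q = C.snd ⟨ℓ, s⟩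
        · rw [h2, Function.update_self, hj, OneMemClass.coe_one, Matrix.mul_one]
        rw [Function.update_of_ne h2]
        by_cases h1 : q = C.fst ⟨ℓ, s⟩
        · rw [h1, Function.update_self, hi, OneMemClass.coe_one, Matrix.mul_one]
        rw [Function.update_of_ne h1, hk q h1 h2, Matrix.one_mul]
      have hc := hloc (fun q => (pending C w ℓ (s + 1) q : Op1))
        (by simp only [hi, OneMemClass.coe_one]) (by simp only [hj, OneMemClass.coe_one])
      rw [gateMap_shiftSample] at hc
      rw [gateMap_shiftSample, hc, LinearMap.comp_assoc, LinearMap.comp_assoc, habs,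
        LinearMap.comp_assoc]
  have h0 : ∀ q, pending C w ℓ 0 q = carried C w ℓ q := fun q =>
    if_pos fun s hs => absurd hs (Nat.not_lt_zero _)
  -- Every qubit is touched in every layer, so nothing is pending when the noise is reached.
  have h1 : ∀ q, pending C w ℓ (C.len ℓ) q = 1 := fun q => by
    refine if_neg fun h => ?_
    obtain ⟨s, _, hs⟩ := C.covers ℓ q
    rcases hs with hs | hs
    · exact (h s s.2).1 hs
    · exact (h s s.2).2 hs
  simp only [h0, h1] at h
  simp only [OneMemClass.coe_one, tensorOp_one] at h
  rw [conjMap_one, LinearMap.id_comp] at h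
  exact h

lemma finalMap_shiftSample (ω : C.Sample) (ℓ : Fin L) :
    conjMap (tensorOp fun q => (carried C w (ℓ + 1) q : Op1)) ∘ₗ
        finalMap C (shiftSample C w ω) ℓ =
      finalMap C ω ℓ ∘ₗ conjMap (tensorOp fun q => (w ℓ q : Op1)) := by
  rw [carried, dif_pos ℓ.2, Fin.eta, finalMap, finalMap]
  by_cases h : C.hasSingle ℓ = true
  · rw [if_pos h, if_pos h, if_pos h, ← conjMap_mul, ← conjMap_mul, tensorOp_mul, tensorOp_mul]
    congr 3
    funext q
    simp [shiftSample, singleShift, h]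
  · rw [if_neg h, if_neg h, if_neg h, LinearMap.id_comp, LinearMap.comp_id]

lemma probeMap_eq_foldMap (N : Op1 →ₗ[ℂ] Op1) (θ : C.Pos → ℝ) (D : C.Pos → QOp n →ₗ[ℂ] QOp n)
    (ω : C.Sample) : probeMap C N θ D ω = foldMap (List.finRange L) fun ℓ =>
      finalMap C ω ℓ ∘ₗ tensorPowerMap N n ∘ₗ gatesMap C θ D ω ℓ := rfl

variable {C} in
lemma probeMap_shiftSample (N : Op1 →ₗ[ℂ] Op1) (θ : C.Pos → ℝ)
    {D : C.Pos → QOp n →ₗ[ℂ] QOp n} (hD : ∀ g, IsLocal (C.fst g) (C.snd g) (D g))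
    (ω : C.Sample) :
    probeMap C N θ D (shiftSample C w ω) = foldMap (List.finRange L) fun ℓ =>
      finalMap C ω ℓ ∘ₗ conjMap (tensorOp fun q => (w ℓ q : Op1)) ∘ₗ tensorPowerMap N n ∘ₗ
        gatesMap C θ D ω ℓ := by
  have h := foldMap_finRange_intertwine L
    (fun ℓ => finalMap C ω ℓ ∘ₗ conjMap (tensorOp fun q => (w ℓ q : Op1)) ∘ₗ
      tensorPowerMap N n ∘ₗ gatesMap C θ D ω ℓ)
    (fun ℓ => finalMap C (shiftSample C w ω) ℓ ∘ₗ tensorPowerMap N n ∘ₗ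
      gatesMap C θ D (shiftSample C w ω) ℓ)
    (fun k => conjMap (tensorOp fun q => (carried C w k q : Op1))) fun ℓ => by
      rw [gatesMap_shiftSample w θ hD, ← LinearMap.comp_assoc, finalMap_shiftSample,
        LinearMap.comp_assoc, LinearMap.comp_assoc, LinearMap.comp_assoc, LinearMap.comp_assoc]
  have h0 : carried C w 0 = 1 := rfl
  -- Nothing is carried out of the circuit: the last single-qubit layer is always present and
  -- absorbs the last insertion.
  have hL : carried C w L = 1 := by
    rcases L with _ | L
    · rfl
    · simp [carried, C.hasSingle_last ⟨L, by omega⟩ rfl]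
  have h1 : conjMap (tensorOp fun q => (carried C w 0 q : Op1)) = LinearMap.id := by
    simp only [h0, Pi.one_apply, OneMemClass.coe_one, tensorOp_one, conjMap_one]
  have h2 : conjMap (tensorOp fun q => (carried C w L q : Op1)) = LinearMap.id := by
    simp only [hL, Pi.one_apply, OneMemClass.coe_one, tensorOp_one, conjMap_one]
  rw [h1, h2, LinearMap.id_comp, LinearMap.comp_id] at h
  rw [probeMap_eq_foldMap, h]

end circuit

/-! ### Continuity and second moments of the amplitude -/

section moments
variable {n L : ℕ} (C : RandomCircuit n L)

lemma continuous_foldMap {X α M : Type} [TopologicalSpace X] [AddCommMonoid M] [Module ℂ M]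
    [TopologicalSpace M] (l : List α) (T : X → α → M →ₗ[ℂ] M)
    (hT : ∀ x ∈ l, ∀ σ : X → M, Continuous σ → Continuous fun y => T y x (σ y))
    (σ : X → M) (hσ : Continuous σ) : Continuous fun y => foldMap l (T y) (σ y) := by
  induction l generalizing σ with
  | nil => exact hσ
  | cons x l ih =>
    exact ih (fun x' hx' => hT x' (by simp [hx'])) _ (hT x (by simp) σ hσ)

lemma continuous_conjMap {X ι : Type} [TopologicalSpace X] [Fintype ι] [DecidableEq ι]
    {A σ : X → Matrix ι ι ℂ}
    (hA : Continuous A) (hσ : Continuous σ) : Continuous fun y => conjMap (A y) (σ y) := by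
  simp only [conjMap_apply]
  exact (hA.mul hσ).mul hA.star

lemma continuous_linearMap {ι κ : Type} [Fintype ι] [Fintype κ]
    (T : Matrix ι ι ℂ →ₗ[ℂ] Matrix κ κ ℂ) : Continuous T := by
  classical exact T.continuous_of_finiteDimensional

lemma continuous_gate (θ : C.Pos → ℝ) (g : C.Pos) : Continuous fun ω => C.gate θ ω g := by
  cases hg : C.generator g with
  | none =>
    simp only [gate_of_random C θ _ hg]
    exact continuous_coe_UGroup.comp ((continuous_apply g).comp continuous_fst)
  | some H =>
    simp only [gate_of_generator C θ _ hg]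
    exact continuous_const

lemma continuous_tensorOp {X : Type} [TopologicalSpace X] {A : X → Fin n → Op1}
    (hA : ∀ k, Continuous fun y => A y k) : Continuous fun y => tensorOp (A y) := by
  refine continuous_matrix fun a b => ?_
  simp only [tensorOp]
  exact continuous_finsetProd _ fun k _ => (hA k).matrix_elem _ _

lemma continuous_probeMap (N : Op1 →ₗ[ℂ] Op1) (θ : C.Pos → ℝ)
    (D : C.Pos → QOp n →ₗ[ℂ] QOp n) (ρ : QOp n) :
    Continuous fun ω => probeMap C N θ D ω ρ := by
  refine continuous_foldMap _ _ (fun ℓ _ σ hσ => ?_) _ continuous_const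
  have h1 : Continuous fun ω => tensorPowerMap N n (gatesMap C θ D ω ℓ (σ ω)) := by
    refine (continuous_linearMap _).comp ?_
    refine continuous_foldMap _ _ (fun s _ σ hσ => ?_) _ hσ
    refine (continuous_linearMap (D ⟨ℓ, s⟩)).comp (continuous_conjMap ?_ hσ)
    exact (continuous_linearMap (onQubitsHom (C.fst_ne_snd ⟨ℓ, s⟩)).toLinearMap).comp
      (continuous_gate C θ ⟨ℓ, s⟩)
  change Continuous fun ω => finalMap C ω ℓ (tensorPowerMap N n (gatesMap C θ D ω ℓ (σ ω)))
  by_cases h : C.hasSingle ℓ = true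
  · simp only [finalMap, h, if_true]
    refine continuous_conjMap (continuous_tensorOp fun q => ?_) h1
    exact continuous_coe_UGroup.comp ((continuous_apply (ℓ, q)).comp continuous_snd)
  · simp only [finalMap, h]
    exact h1

lemma continuous_amplitude (N : Op1 →ₗ[ℂ] Op1) (ρ₀ : QOp n) (p : Fin n → Fin 4)
    (θ : C.Pos → ℝ) (D : C.Pos → QOp n →ₗ[ℂ] QOp n) :
    Continuous (amplitude C N ρ₀ p θ D) :=
  (continuous_const.matrix_mul (continuous_probeMap C N θ D ρ₀)).matrix_trace

instance isProbabilityMeasure_law : IsProbabilityMeasure C.law := by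
  have := C.gateLaw_prob
  have := C.singleLaw_prob
  unfold RandomCircuit.law
  infer_instance

/-- The maps `D` are only inserted after parametrized gates. -/
def TrivialOnRandom (D : C.Pos → QOp n →ₗ[ℂ] QOp n) : Prop :=
  ∀ g, C.generator g = none → D g = LinearMap.id

/-- The random gate stands at one position, where no map is inserted, so the amplitude sees it
through a single conjugation. -/
lemma isSesquilinear_gate (N : Op1 →ₗ[ℂ] Op1) (ρ₀ : QOp n) (p : Fin n → Fin 4)
    (θ : C.Pos → ℝ) {D : C.Pos → QOp n →ₗ[ℂ] QOp n} (hD : TrivialOnRandom C D)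
    {g : C.Pos} (hg : C.generator g = none) (ω₁ : C.Pos → UGroup (Fin 2 × Fin 2))
    (ω₂ : Fin L × Fin n → UGroup (Fin 2)) :
    IsSesquilinear fun u => amplitude C N ρ₀ p θ D (Function.update ω₁ g u, ω₂) := by
  obtain ⟨R, T, h⟩ := circuitMap_update_gate C.len (tensorPowerMap N n)
    (fun g => D g ∘ₗ gateMap C θ (ω₁, ω₂) g) (finalMap C (ω₁, ω₂)) g
  have h1 : ∀ u, probeMap C N θ D (Function.update ω₁ g u, ω₂) =
      R ∘ₗ conjMap (onQubits (C.fst g) (C.snd g) (u : Op2)) ∘ₗ T := by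
    intro u
    rw [← h, probeMap]
    congr 1
    funext g'
    by_cases hg' : g' = g
    · subst hg'
      rw [Function.update_self, hD _ hg, gateMap, gate_of_random C θ _ hg, LinearMap.id_comp]
      dsimp only
      rw [Function.update_self]
    · rw [Function.update_of_ne hg', gateMap, gateMap,
        gate_congr C θ (ω' := (ω₁, ω₂)) (Function.update_of_ne hg' _ _)]
  simp only [amplitude, h1]
  exact isSesquilinear_conjMap (onQubitsHom (C.fst_ne_snd g)).toLinearMap
    (traceLinearMap _ ℂ ℂ ∘ₗ LinearMap.mulLeft ℂ (pauliString p) ∘ₗ R) (T ρ₀)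

/-- The tensor product as a linear map in one factor. -/
def tensorOpUpdate (V : Fin n → Op1) (q : Fin n) : Op1 →ₗ[ℂ] QOp n where
  toFun A := tensorOp (Function.update V q A)
  map_add' A B := by
    ext x y
    simp only [tensorOp, Matrix.add_apply]
    rw [← Finset.mul_prod_erase _ _ (Finset.mem_univ q),
      ← Finset.mul_prod_erase _ _ (Finset.mem_univ q),
      ← Finset.mul_prod_erase (a := q) _ _ (Finset.mem_univ q)]
    simp only [Function.update_self, Matrix.add_apply, add_mul]
    congr 2 <;> refine Finset.prod_congr rfl fun k hk => ?_ <;>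
      simp [Function.update_of_ne (Finset.ne_of_mem_erase hk)]
  map_smul' c A := by
    ext x y
    simp only [tensorOp, Matrix.smul_apply, RingHom.id_apply]
    rw [← Finset.mul_prod_erase _ _ (Finset.mem_univ q),
      ← Finset.mul_prod_erase (a := q) _ _ (Finset.mem_univ q)]
    simp only [Function.update_self, Matrix.smul_apply, smul_eq_mul, mul_assoc]
    congr 2; refine Finset.prod_congr rfl fun k hk => ?_
    simp [Function.update_of_ne (Finset.ne_of_mem_erase hk)]

lemma isSesquilinear_single (N : Op1 →ₗ[ℂ] Op1) (ρ₀ : QOp n) (p : Fin n → Fin 4)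
    (θ : C.Pos → ℝ) (D : C.Pos → QOp n →ₗ[ℂ] QOp n) {k : Fin L × Fin n}
    (hk : C.hasSingle k.1 = true) (ω₁ : C.Pos → UGroup (Fin 2 × Fin 2))
    (ω₂ : Fin L × Fin n → UGroup (Fin 2)) :
    IsSesquilinear fun u => amplitude C N ρ₀ p θ D (ω₁, Function.update ω₂ k u) := by
  obtain ⟨ℓ, q⟩ := k
  obtain ⟨R, T, h⟩ := circuitMap_update_final C.len (tensorPowerMap N n)
    (fun g => D g ∘ₗ gateMap C θ (ω₁, ω₂) g) (finalMap C (ω₁, ω₂)) ℓ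
  have h1 : ∀ u, probeMap C N θ D (ω₁, Function.update ω₂ (ℓ, q) u) =
      R ∘ₗ conjMap (tensorOpUpdate (fun q => (ω₂ (ℓ, q) : Op1)) q (u : Op1)) ∘ₗ T := by
    intro u
    rw [← h, probeMap]
    congr 1
    funext ℓ'
    by_cases hℓ : ℓ' = ℓ
    · subst hℓ
      rw [Function.update_self, finalMap, if_pos hk]
      congr 1
      simp only [tensorOpUpdate, LinearMap.coe_mk, AddHom.coe_mk]
      congr 1
      funext q'
      by_cases hq : q' = q
      · subst hq; simp
      · rw [Function.update_of_ne hq, Function.update_of_ne (by simpa using hq)]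
    · rw [Function.update_of_ne hℓ, finalMap, finalMap]
      congr 3
      funext q'
      dsimp only
      rw [Function.update_of_ne (by simp [hℓ])]
  simp only [amplitude, h1]
  exact isSesquilinear_conjMap (tensorOpUpdate (fun q => (ω₂ (ℓ, q) : Op1)) q)
    (traceLinearMap _ ℂ ℂ ∘ₗ LinearMap.mulLeft ℂ (pauliString p) ∘ₗ R) (T ρ₀)

lemma integrable_of_continuous {f : C.Sample → ℝ} (hf : Continuous f) : Integrable f C.law :=
  hf.integrable_of_hasCompactSupport (HasCompactSupport.of_compactSpace _)

/-- Inserting single-qubit unitaries after the noise does not change the second moment. -/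
lemma integral_norm_sq_shiftSample (N : Op1 →ₗ[ℂ] Op1) (ρ₀ : QOp n) (p : Fin n → Fin 4)
    (θ : C.Pos → ℝ) {D : C.Pos → QOp n →ₗ[ℂ] QOp n} (hD : TrivialOnRandom C D)
    (w : Fin L → Fin n → UGroup (Fin 2)) :
    ∫ ω, ‖amplitude C N ρ₀ p θ D (shiftSample C w ω)‖ ^ 2 ∂C.law =
      ∫ ω, ‖amplitude C N ρ₀ p θ D ω‖ ^ 2 ∂C.law := by
  have := C.gateLaw_prob
  have := C.singleLaw_prob
  have hZ := continuous_amplitude C N ρ₀ p θ D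
  have hs : Continuous fun ω₁ : C.Pos → UGroup (Fin 2 × Fin 2) => ω₁ * gateShift C w :=
    continuous_mul_const _
  have ht : Continuous fun ω₂ : Fin L × Fin n → UGroup (Fin 2) => ω₂ * singleShift C w :=
    continuous_mul_const _
  have hm : ∀ {f : C.Sample → ℂ}, Continuous f →
      Measurable fun ω => ENNReal.ofReal (‖f ω‖ ^ 2) := fun hf =>
    (hf.norm.pow 2).measurable.ennreal_ofReal
  have hZ₁ : Continuous fun ω : C.Sample => amplitude C N ρ₀ p θ D (ω.1 * gateShift C w, ω.2) :=
    hZ.comp ((hs.comp continuous_fst).prodMk continuous_snd)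
  have hZ₂ : Continuous fun ω : C.Sample => amplitude C N ρ₀ p θ D (shiftSample C w ω) :=
    hZ.comp ((hs.comp continuous_fst).prodMk (ht.comp continuous_snd))
  have key : ∫⁻ ω, ENNReal.ofReal (‖amplitude C N ρ₀ p θ D (shiftSample C w ω)‖ ^ 2) ∂C.law =
      ∫⁻ ω, ENNReal.ofReal (‖amplitude C N ρ₀ p θ D ω‖ ^ 2) ∂C.law := by
    -- The two families of gates are treated in turn: first the single-qubit shift is removed with
    -- the two-qubit gates fixed, then the reverse.
    calc _ = ∫⁻ ω, ENNReal.ofReal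
            (‖amplitude C N ρ₀ p θ D (ω.1 * gateShift C w, ω.2)‖ ^ 2) ∂C.law := by
          rw [RandomCircuit.law, lintegral_prod _ (hm hZ₂).aemeasurable,
            lintegral_prod _ (hm hZ₁).aemeasurable]
          refine lintegral_congr fun ω₁ => ?_
          refine lintegral_pi_norm_sq_mul_right C.singleLaw
            (fun ω₂ => amplitude C N ρ₀ p θ D (ω₁ * gateShift C w, ω₂))
            (hZ.comp (continuous_const.prodMk continuous_id)) (singleShift C w) fun k => ?_
          by_cases hk : C.hasSingle k.1 = true
          · exact Or.inr ⟨C.singleLaw_design k hk, fun ω₂ =>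
              isSesquilinear_single C N ρ₀ p θ D hk _ ω₂⟩
          · exact Or.inl (if_neg hk)
      _ = _ := by
          rw [RandomCircuit.law, lintegral_prod_symm _ (hm hZ₁).aemeasurable,
            lintegral_prod_symm _ (hm hZ).aemeasurable]
          refine lintegral_congr fun ω₂ => ?_
          refine lintegral_pi_norm_sq_mul_right C.gateLaw
            (fun ω₁ => amplitude C N ρ₀ p θ D (ω₁, ω₂))
            (hZ.comp (continuous_id.prodMk continuous_const)) (gateShift C w) fun g => ?_
          cases hg : C.generator g with
          | none => exact Or.inr ⟨C.gateLaw_design g hg, fun ω₁ =>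
              isSesquilinear_gate C N ρ₀ p θ hD hg ω₁ ω₂⟩
          | some H => exact Or.inl (gateShift_of_generator C w hg)
  have hint : ∀ {f : C.Sample → ℂ}, Continuous f →
      ∫ ω, ‖f ω‖ ^ 2 ∂C.law = (∫⁻ ω, ENNReal.ofReal (‖f ω‖ ^ 2) ∂C.law).toReal := fun hf =>
    integral_eq_lintegral_of_nonneg_ae (Filter.Eventually.of_forall fun ω => by positivity)
      (hf.norm.pow 2).aestronglyMeasurable
  rw [hint hZ₂, hint hZ, key]

/-- Conjugating a Pauli string by single-qubit unitaries preserves the weight. -/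
lemma pauliWeight_eq_of_pauliCoeff_ne_zero {V : Fin n → UGroup (Fin 2)} {p q : Fin n → Fin 4}
    (h : pauliCoeff ((tensorOp fun k => (V k : Op1))ᴴ * pauliString p *
      tensorOp fun k => (V k : Op1)) q ≠ 0) : pauliWeight q = pauliWeight p := by
  have h1 : ∏ k, (pauli (q k) * ((V k : Op1)ᴴ * pauli (p k) * (V k : Op1))).trace ≠ 0 := by
    rw [← trace_tensorOp]
    have h2 := right_ne_zero_of_mul h
    rwa [tensorOp_conjTranspose, pauliString, pauliString, tensorOp_mul, tensorOp_mul,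
      tensorOp_mul] at h2
  rw [Finset.prod_ne_zero_iff] at h1
  -- On each qubit, conjugation preserves both the identity and tracelessness, so the trace vanishes
  -- if exactly one of the two letters is `I`.
  have h3 : ∀ k, q k = 0 ↔ p k = 0 := by
    intro k
    have hk := h1 k (Finset.mem_univ k)
    constructor
    · intro hq
      by_contra hp
      apply hk
      rw [hq, pauli_zero, Matrix.one_mul, trace_conj_unitary (V k).2, trace_pauli, if_neg hp]
    · intro hp
      by_contra hq
      apply hk
      have : (V k : Op1)ᴴ * (V k : Op1) = 1 := mem_unitaryGroup_iff'.mp (V k).2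
      rw [hp, pauli_zero, Matrix.mul_one, this, Matrix.mul_one, trace_pauli, if_neg hq]
  simp only [pauliWeight, ne_eq, h3]

lemma dualBound_gatesMap (θ : C.Pos → ℝ) {D : C.Pos → QOp n →ₗ[ℂ] QOp n} {κ : C.Pos → ℝ}
    (hκ : ∀ g, 0 ≤ κ g) (hDκ : ∀ g, DualBound (κ g) (D g)) (ω : C.Sample) (ℓ : Fin L) :
    DualBound (∏ s, κ ⟨ℓ, s⟩) (gatesMap C θ D ω ℓ) := by
  have h := dualBound_foldMap (List.finRange (C.len ℓ)) (κ := fun s => κ ⟨ℓ, s⟩)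
    (T := fun s => D ⟨ℓ, s⟩ ∘ₗ gateMap C θ ω ⟨ℓ, s⟩) (fun s => hκ _) fun s => by
      have := (hDκ ⟨ℓ, s⟩).comp (dualBound_gateMap C θ ω ⟨ℓ, s⟩) zero_le_one
      rwa [one_mul] at this
  rwa [← List.ofFn_eq_map, List.prod_ofFn] at h

/-- The bound on the second moment. -/
lemma integral_norm_sq_amplitude_le {N : Op1 →ₗ[ℂ] Op1} (hN : IsChannel N)
    (hunital : IsUnital N) {ρ₀ : QOp n} (hρ : IsState ρ₀) {p : Fin n → Fin 4} (hp : p ≠ 0)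
    (hL : 1 ≤ L) (θ : C.Pos → ℝ) {D : C.Pos → QOp n →ₗ[ℂ] QOp n} (hD : TrivialOnRandom C D)
    (hloc : ∀ g, IsLocal (C.fst g) (C.snd g) (D g)) {κ : C.Pos → ℝ} (hκ : ∀ g, 0 ≤ κ g)
    (hDκ : ∀ g, DualBound (κ g) (D g)) :
    ∫ ω, ‖amplitude C N ρ₀ p θ D ω‖ ^ 2 ∂C.law ≤
      (∏ g, κ g) ^ 2 * contraction N ^ (pauliWeight p + L - 1) := by
  obtain ⟨M, rfl⟩ : ∃ M, L = M + 1 := ⟨L - 1, by omega⟩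
  let W := Fin (M + 1) → Fin n → TwirlIndex
  let sh : W → C.Sample → C.Sample := fun w => shiftSample C fun ℓ q => twirlGate (w ℓ q)
  have hcard : (0 : ℝ) < Fintype.card W := by
    exact_mod_cast Fintype.card_pos
  -- The bound already holds for every fixed sample after averaging over the insertions alone;
  -- integration is only needed to compare the shifted samples with the original one.
  have hpt : ∀ ω, ∑ w : W, ‖amplitude C N ρ₀ p θ D (sh w ω)‖ ^ 2 ≤
      Fintype.card W * ((∏ g, κ g) ^ 2 * contraction N ^ (pauliWeight p + M)) := by
    intro ω
    have hlast : finalMap C ω (Fin.last M) =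
        conjMap (tensorOp fun q => (ω.2 (Fin.last M, q) : Op1)) :=
      if_pos (C.hasSingle_last _ rfl)
    have hV := tensorOp_mem_unitary fun q => (ω.2 (Fin.last M, q)).2
    have h := sum_twirledCircuit_pauliString_le hN hunital hρ
      (dualBound_gatesMap C θ hκ hDκ ω) (dualBound_finalMap C ω)
      ((List.finRange M).map Fin.castSucc) (Fin.last M)
      (by rw [← List.finRange_succ_last]; exact List.nodup_finRange _)
      ((tensorOp fun q => (ω.2 (Fin.last M, q) : Op1))ᴴ * pauliString p *
        tensorOp fun q => (ω.2 (Fin.last M, q) : Op1))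
      (by rw [trace_conj_unitary hV, trace_pauliString_of_ne_zero hp])
      ((norm_conjMap_unitary_le hV _).trans (norm_of_unitary (pauliString_mem_unitary p)).le)
      (fun σ => by rw [hlast, trace_mul_conjMap])
      (fun q hq => pauliWeight_eq_of_pauliCoeff_ne_zero
        (V := fun q => ω.2 (Fin.last M, q)) hq)
    rw [← List.finRange_succ_last] at h
    simp only [List.length_map, List.length_finRange] at h
    rw [← List.ofFn_eq_map, List.prod_ofFn, Finset.prod_pow] at h
    have h2 : ∏ ℓ, ∏ s, κ ⟨ℓ, s⟩ = ∏ g, κ g :=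
      (Fintype.prod_sigma κ).symm
    rw [h2] at h
    have h3 : ∀ w : W, amplitude C N ρ₀ p θ D (sh w ω) = (pauliString p *
        twirledCircuit N (gatesMap C θ D ω) (finalMap C ω) (List.finRange (M + 1)) w ρ₀).trace := by
      intro w
      rw [amplitude, probeMap_shiftSample _ N θ hloc]
      rfl
    simp only [h3]
    rw [mul_assoc] at h
    exact h
  have hcont : ∀ w : W, Continuous fun ω => ‖amplitude C N ρ₀ p θ D (sh w ω)‖ ^ 2 := by
    intro w
    have hs : Continuous (sh w) :=
      ((continuous_mul_const _).comp continuous_fst).prodMk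
        ((continuous_mul_const _).comp continuous_snd)
    exact (((continuous_amplitude C N ρ₀ p θ D).comp hs).norm.pow 2)
  -- All insertions have the same second moment as the unmodified circuit.
  have h1 : ∫ ω, ∑ w : W, ‖amplitude C N ρ₀ p θ D (sh w ω)‖ ^ 2 ∂C.law =
      Fintype.card W * ∫ ω, ‖amplitude C N ρ₀ p θ D ω‖ ^ 2 ∂C.law := by
    rw [integral_finsetSum _ fun w _ => integrable_of_continuous C (hcont w)]
    simp only [sh, integral_norm_sq_shiftSample C N ρ₀ p θ hD]
    simp
  have h2 : ∫ ω, ∑ w : W, ‖amplitude C N ρ₀ p θ D (sh w ω)‖ ^ 2 ∂C.law ≤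
      Fintype.card W * ((∏ g, κ g) ^ 2 * contraction N ^ (pauliWeight p + M)) := by
    calc _ ≤ ∫ _, Fintype.card W * ((∏ g, κ g) ^ 2 * contraction N ^ (pauliWeight p + M))
            ∂C.law :=
          integral_mono (integrable_of_continuous C (continuous_finsetSum _ fun w _ => hcont w))
            (integrable_const _) hpt
      _ = _ := by simp
  rw [h1] at h2
  exact le_of_mul_le_mul_left h2 hcard

lemma memLp_re_amplitude (N : Op1 →ₗ[ℂ] Op1) (ρ₀ : QOp n) (p : Fin n → Fin 4)
    (θ : C.Pos → ℝ) (D : C.Pos → QOp n →ₗ[ℂ] QOp n) :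
    MemLp (fun ω => (amplitude C N ρ₀ p θ D ω).re) 2 C.law := by
  have h := Complex.continuous_re.comp (continuous_amplitude C N ρ₀ p θ D)
  obtain ⟨B, hB⟩ := (isCompact_range h).isBounded.exists_norm_le
  exact MemLp.of_bound h.aestronglyMeasurable B
    (Filter.Eventually.of_forall fun ω => hB _ ⟨ω, rfl⟩)

lemma variance_re_amplitude_le (N : Op1 →ₗ[ℂ] Op1) (ρ₀ : QOp n) (p : Fin n → Fin 4)
    (θ : C.Pos → ℝ) (D : C.Pos → QOp n →ₗ[ℂ] QOp n) :
    variance (fun ω => (amplitude C N ρ₀ p θ D ω).re) C.law ≤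
      ∫ ω, ‖amplitude C N ρ₀ p θ D ω‖ ^ 2 ∂C.law := by
  have hc := continuous_amplitude C N ρ₀ p θ D
  have h := Complex.continuous_re.comp hc
  refine (variance_le_expectation_sq h.aestronglyMeasurable).trans ?_
  refine integral_mono (integrable_of_continuous C (h.pow 2))
    (integrable_of_continuous C (hc.norm.pow 2)) fun ω => ?_
  have := Complex.abs_re_le_norm (amplitude C N ρ₀ p θ D ω)
  exact sq_le_sq' (abs_le.mp this).1 (abs_le.mp this).2

end moments

/-! ### Derivatives with respect to the parameters -/

section derivative
variable {n L : ℕ} (C : RandomCircuit n L)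

/-- The derivation `σ ↦ -i [H, σ]`. -/
def adMap (H : QOp n) : QOp n →ₗ[ℂ] QOp n :=
  (-Complex.I) • (LinearMap.mulLeft ℂ H - LinearMap.mulRight ℂ H)

lemma adMap_apply (H σ : QOp n) : adMap H σ = (-Complex.I) • (H * σ - σ * H) := rfl

/-- The dual of a commutator is a commutator, hence traceless, and the triangle inequality gives the
factor `2`. Its square is the constant `4` in the final bound. -/
lemma dualBound_adMap {H : QOp n} (hH : ‖H‖ ≤ 1) : DualBound 2 (adMap H) := fun X _ => by
  refine ⟨(-Complex.I) • (X * H - H * X), ?_, ?_, fun σ => ?_⟩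
  · rw [trace_smul, trace_sub, trace_mul_comm, sub_self, smul_zero]
  · rw [norm_smul, norm_neg, Complex.norm_I, one_mul]
    calc ‖X * H - H * X‖ ≤ ‖X * H‖ + ‖H * X‖ := norm_sub_le _ _
      _ ≤ ‖X‖ * ‖H‖ + ‖H‖ * ‖X‖ := add_le_add (norm_mul_le _ _) (norm_mul_le _ _)
      _ ≤ ‖X‖ * 1 + 1 * ‖X‖ := by gcongr
      _ = 2 * ‖X‖ := by ring
  · rw [adMap_apply, Matrix.mul_smul, Matrix.smul_mul, trace_smul, trace_smul, Matrix.mul_sub,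
      Matrix.sub_mul, trace_sub, trace_sub, Matrix.mul_assoc X H σ, ← Matrix.mul_assoc X σ H,
      trace_mul_comm (X * σ) H, Matrix.mul_assoc H X σ]

lemma isLocal_adMap {i j : Fin n} (hij : i ≠ j) (A : Op2) :
    IsLocal i j (adMap (onQubits i j A)) := fun v hi hj => by
  have h1 := (onQubits_tensorOp_commute hij A v hi hj).eq
  have h2 := (onQubits_tensorOp_commute hij A (fun k => (v k)ᴴ) (by simp [hi])
    (by simp [hj])).eq
  rw [← tensorOp_conjTranspose] at h2
  ext1 σ
  simp only [LinearMap.comp_apply, adMap_apply, map_smul, map_sub, conjMap_apply]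
  congr 2
  · rw [← Matrix.mul_assoc, ← h1]
    simp only [Matrix.mul_assoc]
  · simp only [Matrix.mul_assoc]
    rw [h2]

lemma gate_update_of_ne (θ : C.Pos → ℝ) (ω : C.Sample) {g μ : C.Pos} (h : g ≠ μ) (s : ℝ) :
    C.gate (Function.update θ μ s) ω g = C.gate θ ω g := by
  rw [RandomCircuit.gate, RandomCircuit.gate, Function.update_of_ne h]

/-- The product rule: the derivative falls once on the exponential and once on its adjoint, and for
Hermitian `H` the two terms combine into a commutator. -/
lemma hasDerivAt_conjMap_exp {i j : Fin n} (hij : i ≠ j) {H : Op2} (hH : H.IsHermitian)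
    (σ : QOp n) (s : ℝ) :
    HasDerivAt (fun s : ℝ => conjMap (onQubits i j
        (NormedSpace.exp ((-(Complex.I * (s : ℂ))) • H))) σ)
      (adMap (onQubits i j H) (conjMap (onQubits i j
        (NormedSpace.exp ((-(Complex.I * (s : ℂ))) • H))) σ)) s := by
  have h1 : ∀ s : ℝ, (-(Complex.I * (s : ℂ))) • H = s • ((-Complex.I) • H) := by
    intro s
    rw [← Complex.coe_smul, smul_smul]
    congr 1
    ring
  simp only [h1]
  have h2 := hasDerivAt_exp_smul_const' (𝕂 := ℝ) ((-Complex.I) • H) s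
  let F : Op2 →L[ℝ] QOp n :=
    (onQubitsHom hij).toLinearMap.toContinuousLinearMap.restrictScalars ℝ
  have h3 : HasDerivAt (fun s : ℝ => onQubits i j (NormedSpace.exp (s • ((-Complex.I) • H))))
      (onQubits i j ((-Complex.I) • H * NormedSpace.exp (s • ((-Complex.I) • H)))) s :=
    F.hasFDerivAt.comp_hasDerivAt s h2
  have h4 := (h3.mul_const σ).mul h3.star
  have h5 : onQubits i j ((-Complex.I) • H) = (-Complex.I) • onQubits i j H :=
    map_smul (onQubitsHom hij) _ _
  have h6 : (onQubits i j H)ᴴ = onQubits i j H := by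
    rw [← onQubits_conjTranspose, hH.eq]
  convert! h4 using 1
  rw [onQubits_mul hij, h5, adMap_apply, conjMap_apply, star_mul, star_smul,
    star_eq_conjTranspose, star_eq_conjTranspose, h6]
  simp only [star_neg, Complex.star_def, Complex.conj_I, neg_neg, smul_mul_assoc,
    mul_smul_comm, smul_sub, neg_smul, neg_mul, Matrix.mul_assoc]
  abel

/-- The insertion that computes the partial derivative. -/
def derivInsertion (μ : C.Pos) (H : Op2) : C.Pos → QOp n →ₗ[ℂ] QOp n :=
  Function.update (fun _ => LinearMap.id) μ (adMap (onQubits (C.fst μ) (C.snd μ) H))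

lemma hasDerivAt_costAlong (N : Op1 →ₗ[ℂ] Op1) (ρ₀ : QOp n) (p : Fin n → Fin 4)
    (θ : C.Pos → ℝ) {μ : C.Pos} {H : Op2} (hμ : C.generator μ = some H) (ω : C.Sample) :
    HasDerivAt (C.costAlong N ρ₀ p θ μ ω)
      (amplitude C N ρ₀ p θ (derivInsertion C μ H) ω).re (θ μ) := by
  obtain ⟨R, T, h⟩ := circuitMap_update_gate C.len (tensorPowerMap N n)
    (fun g => gateMap C θ ω g) (finalMap C ω) μ
  have h1 : ∀ s, probeMap C N (Function.update θ μ s) (fun _ => LinearMap.id) ω =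
      R ∘ₗ conjMap (onQubits (C.fst μ) (C.snd μ)
        (NormedSpace.exp ((-(Complex.I * (s : ℂ))) • H))) ∘ₗ T := by
    intro s
    rw [← h, probeMap]
    congr 1
    funext g
    by_cases hg : g = μ
    · subst hg
      rw [Function.update_self, gateMap, gate_of_generator C _ _ hμ, Function.update_self,
        LinearMap.id_comp]
    · rw [Function.update_of_ne hg, gateMap, gate_update_of_ne C θ ω hg, LinearMap.id_comp,
        gateMap]
  have h2 : probeMap C N θ (derivInsertion C μ H) ω =
      R ∘ₗ (adMap (onQubits (C.fst μ) (C.snd μ) H) ∘ₗ conjMap (onQubits (C.fst μ) (C.snd μ)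
        (NormedSpace.exp ((-(Complex.I * (θ μ : ℂ))) • H)))) ∘ₗ T := by
    rw [← h, probeMap]
    congr 1
    funext g
    by_cases hg : g = μ
    · subst hg
      rw [Function.update_self, gateMap, gate_of_generator C _ _ hμ, derivInsertion,
        Function.update_self]
    · rw [Function.update_of_ne hg, derivInsertion, Function.update_of_ne hg, LinearMap.id_comp]
  let f : QOp n →ₗ[ℂ] ℂ := traceLinearMap _ ℂ ℂ ∘ₗ LinearMap.mulLeft ℂ (pauliString p) ∘ₗ R
  let F : QOp n →L[ℝ] ℝ := Complex.reCLM.comp (f.toContinuousLinearMap.restrictScalars ℝ)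
  have h3 := F.hasFDerivAt.comp_hasDerivAt (θ μ) (hasDerivAt_conjMap_exp (C.fst_ne_snd μ)
    (C.isHermitian μ H hμ) (T ρ₀) (θ μ))
  have h4 : C.costAlong N ρ₀ p θ μ ω = F ∘ fun s : ℝ => conjMap (onQubits (C.fst μ) (C.snd μ)
      (NormedSpace.exp ((-(Complex.I * (s : ℂ))) • H))) (T ρ₀) := by
    funext s
    rw [RandomCircuit.costAlong, cost_eq_re_amplitude, amplitude, h1]
    rfl
  rw [h4, amplitude, h2]
  exact h3

lemma costDeriv_eq (N : Op1 →ₗ[ℂ] Op1) (ρ₀ : QOp n) (p : Fin n → Fin 4)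
    (θ : C.Pos → ℝ) {μ : C.Pos} {H : Op2} (hμ : C.generator μ = some H) :
    C.costDeriv N ρ₀ p θ μ = fun ω => (amplitude C N ρ₀ p θ (derivInsertion C μ H) ω).re :=
  funext fun ω => (hasDerivAt_costAlong C N ρ₀ p θ hμ ω).deriv

lemma trivialOnRandom_derivInsertion {μ : C.Pos} {H : Op2} (hμ : C.generator μ = some H) :
    TrivialOnRandom C (derivInsertion C μ H) := fun g hg => by
  rw [derivInsertion, Function.update_of_ne]
  rintro rfl
  rw [hg] at hμ
  cases hμ

lemma isLocal_derivInsertion (μ : C.Pos) (H : Op2) (g : C.Pos) :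
    IsLocal (C.fst g) (C.snd g) (derivInsertion C μ H g) := by
  by_cases hg : g = μ
  · subst hg
    rw [derivInsertion, Function.update_self]
    exact isLocal_adMap (C.fst_ne_snd g) H
  · rw [derivInsertion, Function.update_of_ne hg]
    exact fun v _ _ => rfl

lemma dualBound_derivInsertion (μ : C.Pos) {H : Op2} (hH : ‖H‖ ≤ 1) (g : C.Pos) :
    DualBound (if g = μ then 2 else 1) (derivInsertion C μ H g) := by
  by_cases hg : g = μ
  · subst hg
    rw [derivInsertion, Function.update_self, if_pos rfl]
    exact dualBound_adMap ((norm_onQubits_le (C.fst_ne_snd g) H).trans hH)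
  · rw [derivInsertion, Function.update_of_ne hg, if_neg hg]
    exact dualBound_id

/-! ### The identity observable -/

lemma trace_channel {N : Op1 →ₗ[ℂ] Op1} (hN : IsChannel N) (θ : C.Pos → ℝ) (ω : C.Sample)
    (ρ : QOp n) : (C.channel N θ ω ρ).trace = ρ.trace := by
  have hfold : ∀ {α : Type} (l : List α) (T : α → QOp n →ₗ[ℂ] QOp n)
      (_ : ∀ x σ, (T x σ).trace = σ.trace) (σ : QOp n), (foldMap l T σ).trace = σ.trace := by
    intro α l T hT σ
    induction l generalizing σ with
    | nil => rfl
    | cons x l ih => exact (ih _).trans (hT x σ)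
  have hconj : ∀ {U : QOp n}, U ∈ unitaryGroup (Fin n → Fin 2) ℂ → ∀ σ,
      (conjMap U σ).trace = σ.trace := by
    intro U hU σ
    have h := trace_mul_conjMap 1 U σ
    have h2 : Uᴴ * U = 1 := mem_unitaryGroup_iff'.mp hU
    rwa [Matrix.one_mul, Matrix.mul_one, h2, Matrix.one_mul] at h
  have hnoise : ∀ σ, (tensorPowerMap N n σ).trace = σ.trace := by
    intro σ
    have h := trace_pauliString_mul_tensorPower N (0 : Fin n → Fin 4) σ
    simp only [Pi.zero_apply, heisenberg_zero hN, tensorOp_one, pauliString_zero,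
      Matrix.one_mul] at h
    exact h
  rw [channel_eq_probeMap, probeMap_eq_foldMap]
  refine hfold _ _ (fun ℓ σ => ?_) ρ
  have h1 : (finalMap C ω ℓ (tensorPowerMap N n (gatesMap C θ (fun _ => LinearMap.id) ω ℓ σ))).trace
      = (tensorPowerMap N n (gatesMap C θ (fun _ => LinearMap.id) ω ℓ σ)).trace := by
    rw [finalMap]
    split_ifs
    · exact hconj (tensorOp_mem_unitary fun q => (ω.2 (ℓ, q)).2) _
    · rfl
  refine h1.trans ((hnoise _).trans (hfold _ _ (fun s σ => ?_) σ))
  exact hconj (onQubits_mem_unitary (C.fst_ne_snd _) (gate_mem_unitary C θ ω _)) σ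

lemma cost_zero {N : Op1 →ₗ[ℂ] Op1} (hN : IsChannel N) (ρ₀ : QOp n) (θ : C.Pos → ℝ)
    (ω : C.Sample) : C.cost N ρ₀ 0 θ ω = ρ₀.trace.re := by
  rw [RandomCircuit.cost, pauliString_zero, Matrix.one_mul, trace_channel C hN]

lemma costDeriv_zero {N : Op1 →ₗ[ℂ] Op1} (hN : IsChannel N) (ρ₀ : QOp n) (θ : C.Pos → ℝ)
    (μ : C.Pos) (ω : C.Sample) : C.costDeriv N ρ₀ 0 θ μ ω = 0 := by
  have h : C.costAlong N ρ₀ 0 θ μ ω = fun _ => ρ₀.trace.re :=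
    funext fun s => cost_zero C hN ρ₀ _ ω
  rw [RandomCircuit.costDeriv, h, deriv_const]

/-! ### The variance bounds -/

lemma variance_cost_le {N : Op1 →ₗ[ℂ] Op1} (hN : IsChannel N) (hunital : IsUnital N)
    {ρ₀ : QOp n} (hρ : IsState ρ₀) (hL : 1 ≤ L) (p : Fin n → Fin 4) (θ : C.Pos → ℝ) :
    variance (C.cost N ρ₀ p θ) C.law ≤ 4 * contraction N ^ (pauliWeight p + L - 1) := by
  have hc : 0 ≤ contraction N ^ (pauliWeight p + L - 1) := pow_nonneg (contraction_nonneg N) _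
  by_cases hp : p = 0
  · subst hp
    have h : C.cost N ρ₀ 0 θ = fun _ => ρ₀.trace.re := funext fun ω => cost_zero C hN ρ₀ θ ω
    rw [h, variance_eq_integral aemeasurable_const]
    simp only [integral_const, probReal_univ, one_smul, sub_self]
    simp
    exact hc
  · have h := integral_norm_sq_amplitude_le C hN hunital hρ hp hL θ
      (D := fun _ => LinearMap.id) (fun _ _ => rfl) (fun _ _ _ _ => rfl) (κ := fun _ => 1)
      (fun _ => zero_le_one) (fun _ => dualBound_id)
    have h2 : C.cost N ρ₀ p θ = fun ω => (amplitude C N ρ₀ p θ (fun _ => LinearMap.id) ω).re :=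
      funext fun ω => cost_eq_re_amplitude C N ρ₀ p θ ω
    rw [h2]
    refine (variance_re_amplitude_le C N ρ₀ p θ _).trans (h.trans ?_)
    rw [Finset.prod_const_one, one_pow, one_mul]
    -- The second moment of the cost itself is bounded with constant `1`; the factor `4` is slack
    -- here.
    linarith

lemma variance_costDeriv_le {N : Op1 →ₗ[ℂ] Op1} (hN : IsChannel N) (hunital : IsUnital N)
    {ρ₀ : QOp n} (hρ : IsState ρ₀) (p : Fin n → Fin 4) (θ : C.Pos → ℝ) {μ : C.Pos}
    {H : Op2} (hμ : C.generator μ = some H) (hH : ‖H‖ ≤ 1) :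
    variance (C.costDeriv N ρ₀ p θ μ) C.law ≤
      4 * contraction N ^ (pauliWeight p + L - 1) := by
  have hc : 0 ≤ contraction N ^ (pauliWeight p + L - 1) := pow_nonneg (contraction_nonneg N) _
  -- The position `μ` lies in some layer.
  have hL : 1 ≤ L := Nat.one_le_iff_ne_zero.mpr fun h => (h ▸ μ.1).elim0
  by_cases hp : p = 0
  · subst hp
    have h : C.costDeriv N ρ₀ 0 θ μ = 0 := funext fun ω => costDeriv_zero C hN ρ₀ θ μ ω
    rw [h, variance_zero]
    positivity
  · have h := integral_norm_sq_amplitude_le C hN hunital hρ hp hL θ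
      (trivialOnRandom_derivInsertion C hμ) (isLocal_derivInsertion C μ H)
      (κ := fun g => if g = μ then 2 else 1) (fun g => by split_ifs <;> norm_num)
      (dualBound_derivInsertion C μ hH)
    rw [costDeriv_eq C N ρ₀ p θ hμ]
    refine (variance_re_amplitude_le C N ρ₀ p θ _).trans (h.trans ?_)
    rw [Finset.prod_ite_eq' Finset.univ μ, if_pos (Finset.mem_univ μ)]
    norm_num

end derivative

/-- Half of the logarithmic decay rate is kept as `α`; for large `m` the other half absorbs the
constant `4 / d`. -/
lemma exists_rate {c : ℝ} (h0 : 0 ≤ c) (h1 : c < 1) :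
    ∃ α : ℝ, 0 < α ∧ ∃ m₀ : ℕ, ∀ m : ℕ, 1 ≤ m → m₀ ≤ m →
      4 * c ^ (m - 1) ≤ Real.exp (-(α * m)) := by
  -- Replacing `c` by a positive number below `1` covers `c = 0`, where the logarithm would carry no
  -- information.
  set d := max c (1 / 2) with hd
  have hd0 : 0 < d := lt_of_lt_of_le (by norm_num) (le_max_right _ _)
  have hd1 : d < 1 := max_lt h1 (by norm_num)
  have hlog : Real.log d < 0 := Real.log_neg hd0 hd1
  refine ⟨-Real.log d / 2, by linarith, ⌈Real.log (4 / d) / (-Real.log d / 2)⌉₊,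
    fun m hm1 hm => ?_⟩
  have hm' : Real.log (4 / d) ≤ -Real.log d / 2 * m := by
    have := Nat.ceil_le.mp hm
    rw [div_le_iff₀ (by linarith)] at this
    linarith
  calc 4 * c ^ (m - 1) ≤ 4 * d ^ (m - 1) := by gcongr; exact le_max_left _ _
    _ = 4 / d * d ^ m := by
      obtain ⟨k, rfl⟩ : ∃ k, m = k + 1 := ⟨m - 1, by omega⟩
      rw [Nat.add_sub_cancel, pow_succ]
      field_simp
    _ = Real.exp (Real.log (4 / d) + m * Real.log d) := by
      rw [Real.exp_add, Real.exp_log (by positivity), Real.exp_nat_mul, Real.exp_log hd0]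
    _ ≤ Real.exp (-(-Real.log d / 2 * m)) := by
      apply Real.exp_le_exp.mpr
      linarith

end

end NoisyCircuit

theorem mainTheorem8 (N : Op1 →ₗ[ℂ] Op1) (hN : IsChannel N) (hunital : IsUnital N) :
    -- explicit bounds, for every unital noise channel with normal form parameters `t`, `D`
    (∀ t D : EuclideanSpace ℝ (Fin 3), IsNormalForm N t D →
      ∀ (n L : ℕ), 1 ≤ L → ∀ (C : RandomCircuit n L) (ρ₀ : QOp n), IsState ρ₀ →
        ∀ (p : Fin n → Fin 4) (θ : C.Pos → ℝ),
          (MemLp (C.cost N ρ₀ p θ) 2 C.law ∧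
            variance (C.cost N ρ₀ p θ) C.law ≤
              4 * noiseConst t D ^ (pauliWeight p + L - 1)) ∧
          ∀ (μ : C.Pos) (H : Op2), C.generator μ = some H →
            ‖Matrix.toEuclideanCLM (𝕜 := ℂ) H‖ ≤ 1 →
            (∀ ω, DifferentiableAt ℝ (C.costAlong N ρ₀ p θ μ ω) (θ μ)) ∧
            MemLp (C.costDeriv N ρ₀ p θ μ) 2 C.law ∧
            variance (C.costDeriv N ρ₀ p θ μ) C.law ≤
              4 * noiseConst t D ^ (pauliWeight p + L - 1)) ∧
    -- exponential decay, at a rate that depends only on the noise, if it is not unitary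
    (¬ IsUnitaryChannel N →
      (∀ t D : EuclideanSpace ℝ (Fin 3), IsNormalForm N t D → noiseConst t D < 1) ∧
      ∃ α : ℝ, 0 < α ∧ ∃ m₀ : ℕ,
        ∀ (n L : ℕ) (C : RandomCircuit n L) (ρ₀ : QOp n), IsState ρ₀ →
          ∀ (p : Fin n → Fin 4) (θ : C.Pos → ℝ) (μ : C.Pos) (H : Op2),
            C.generator μ = some H → ‖Matrix.toEuclideanCLM (𝕜 := ℂ) H‖ ≤ 1 →
            m₀ ≤ pauliWeight p + L →
            variance (C.costDeriv N ρ₀ p θ μ) C.law ≤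
              Real.exp (-(α * ((pauliWeight p : ℝ) + L)))) := by
  refine ⟨fun t D hnf n L hL C ρ₀ hρ p θ => ?_, fun hU => ⟨fun t D hnf => ?_, ?_⟩⟩
  · rw [NoisyCircuit.noiseConst_eq_contraction hN hunital hnf]
    -- The hypothesis on `Matrix.toEuclideanCLM H` serves as a bound on `‖H‖` because the L2
    -- operator norm of a matrix unfolds to the norm of that map.
    refine ⟨⟨?_, NoisyCircuit.variance_cost_le C hN hunital hρ hL p θ⟩, fun μ H hμ hH => ⟨fun ω =>
      (NoisyCircuit.hasDerivAt_costAlong C N ρ₀ p θ hμ ω).differentiableAt, ?_,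
      NoisyCircuit.variance_costDeriv_le C hN hunital hρ p θ hμ hH⟩⟩
    · rw [funext fun ω => NoisyCircuit.cost_eq_re_amplitude C N ρ₀ p θ ω]
      exact NoisyCircuit.memLp_re_amplitude C N ρ₀ p θ _
    · rw [NoisyCircuit.costDeriv_eq C N ρ₀ p θ hμ]
      exact NoisyCircuit.memLp_re_amplitude C N ρ₀ p θ _
  · rw [NoisyCircuit.noiseConst_eq_contraction hN hunital hnf]
    exact NoisyCircuit.contraction_lt_one hN hU
  · obtain ⟨α, hα, m₀, h⟩ := NoisyCircuit.exists_rate (NoisyCircuit.contraction_nonneg N)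
      (NoisyCircuit.contraction_lt_one hN hU)
    refine ⟨α, hα, m₀, fun n L C ρ₀ hρ p θ μ H hμ hH hm => ?_⟩
    have hL : 1 ≤ L := Nat.one_le_iff_ne_zero.mpr fun h => (h ▸ μ.1).elim0
    refine (NoisyCircuit.variance_costDeriv_le C hN hunital hρ p θ hμ hH).trans ?_
    have := h (pauliWeight p + L) (by omega) hm
    push_cast at this
    exact this
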